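/- Let $\mathfrak g_n$ be either $\mathfrak{gl}(n)$, the Lie algebra of all complex $n\times n$ matrices, or $\mathfrak{so}(n)$, the Lie algebra of complex skew-symmetric $n\times n$ matrices, and for $1\le i\le n$ let $\mathfrak g_i$ be $\mathfrak{gl}(i)$, respectively $\mathfrak{so}(i)$, embedded in $\mathfrak g_n$ as the top left hand $i\times i$ corner (all other entries zero). For $x\in\mathfrak g_n$ let $x_i\in\mathfrak g_i$ denote its top left hand $i\times i$ submatrix (its $i\times i$ cutoff), and let $\mathfrak z_{\mathfrak g_i}(x_i)$ be the centralizer of $x_i$ in $\mathfrak g_i$. Let $r_i$ be the rank of $\mathfrak g_i$, so $r_i=i$ for $\mathfrak{gl}(i)$ and $r_i=\lfloor i/2\rfloor$ for $\mathfrak{so}(i)$; an element $y\in\mathfrak g_i$ is called regular if $\dim\mathfrak z_{\mathfrak g_i}(y)=r_i$. For $1\le i\le n$ and $1\le j\le r_i$ define $f_{i,j}:\mathfrak g_n\to\mathbb C$ as follows: $f_{i,j}(x)=\operatorname{tr}(x_i^{\,j})$ if $\mathfrak g_i=\mathfrak{gl}(i)$; if $\mathfrak g_i=\mathfrak{so}(i)$,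 then $f_{i,j}(x)=\operatorname{tr}(x_i^{\,2j})$ for $i\ne 2j$, and $f_{i,j}(x)=\operatorname{Pfaff}(x_i)$, the Pfaffian, for $i=2j$. An element $x\in\mathfrak g_n$ is called strongly regular if the differentials $(df_{i,j})_x$, $1\le i\le n$, $1\le j\le r_i$, are linearly independent. Then $x\in\mathfrak g_n$ is strongly regular if and only if the following two conditions hold: (a) $x_i$ is regular in $\mathfrak g_i$ for all $1\le i\le n$; (b) $\mathfrak z_{\mathfrak g_i}(x_i)\cap\mathfrak z_{\mathfrak g_{i+1}}(x_{i+1})=0$ for all $1\le i\le n-1$, the intersection being taken in $\mathfrak g_n$. -/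

import Mathlib

attribute [local instance 100] LieRing.ofAssociativeRing

namespace GelfandZeitlin

/-- The two series of Lie algebras under consideration. -/
inductive Series : Type
  | gl
  | so

/-- `𝔤ᵢ`: all complex `i × i` matrices for the series `gl`, and the skew-symmetric ones for the
series `so`, with the commutator bracket. -/
def g : Series → (i : ℕ) → LieSubalgebra ℂ (Matrix (Fin i) (Fin i) ℂ)
  | .gl, _ => ⊤
  | .so, i => LieAlgebra.Orthogonal.so (Fin i) ℂ

/-- The `i × i` cutoff (top left hand corner) of a matrix in `𝔤ₙ`. -/
def cutoff {s : Series} {n : ℕ} (x : g s n) (i : ℕ) (hi : i ≤ n) : g s i :=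
  ⟨(x : Matrix (Fin n) (Fin n) ℂ).submatrix (Fin.castLE hi) (Fin.castLE hi), by
    cases s with
    | gl => exact LieSubalgebra.mem_top _
    | so =>
      have hx := (LieAlgebra.Orthogonal.mem_so (Fin n) ℂ _).1 x.2
      refine (LieAlgebra.Orthogonal.mem_so (Fin i) ℂ _).2 ?_
      rw [Matrix.transpose_submatrix, hx]
      rfl⟩

/-- The embedding of `i × i` matrices into `n × n` matrices as the top left hand corner, all other
entries being zero. -/
noncomputable def embed (i n : ℕ) : Matrix (Fin i) (Fin i) ℂ →ₗ[ℂ] Matrix (Fin n) (Fin n) ℂ where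
  toFun Y := Matrix.of fun k l =>
    if h : (k : ℕ) < i ∧ (l : ℕ) < i then Y ⟨k, h.1⟩ ⟨l, h.2⟩ else 0
  map_add' Y Z := by
    ext k l
    simp only [Matrix.of_apply, Matrix.add_apply]
    split_ifs <;> simp
  map_smul' c Y := by
    ext k l
    simp only [Matrix.of_apply, Matrix.smul_apply, RingHom.id_apply]
    split_ifs <;> simp

/-- The centralizer of `X` in the Lie algebra `𝔤ᵢ`. -/
noncomputable def centralizer {s : Series} {i : ℕ} (X : g s i) : Submodule ℂ (g s i) :=
  LinearMap.ker (LieAlgebra.ad ℂ (g s i) X)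

/-- `X ∈ 𝔤ᵢ` is regular if its centralizer in `𝔤ᵢ` has dimension the rank of `𝔤ᵢ`.
(This is weaker than `LieAlgebra.IsRegular`, which moreover forces `X` to be semisimple.) -/
def IsRegular {s : Series} {i : ℕ} (X : g s i) : Prop :=
  Module.finrank ℂ (centralizer X) = LieAlgebra.rank ℂ (g s i)

/-- For `x ∈ 𝔤ₙ`, the centralizer in `𝔤ᵢ` of the cutoff `xᵢ`, as a space of `n × n` matrices. -/
noncomputable def cutoffCentralizer {s : Series} {n : ℕ} (x : g s n) (i : ℕ) (hi : i ≤ n) :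
    Submodule ℂ (Matrix (Fin n) (Fin n) ℂ) :=
  (centralizer (cutoff x i hi)).map (embed i n ∘ₗ (g s i).toSubmodule.subtype)

/-- The Pfaffian of a skew-symmetric matrix of even size `i = 2l`:
`(1 / (2 ^ l * l!)) * ∑ σ, sign σ * ∏ k < l, M (σ (2k)) (σ (2k + 1))`. Only used for even `i`. -/
noncomputable def pfaffian {i : ℕ} (M : Matrix (Fin i) (Fin i) ℂ) : ℂ :=
  ((2 : ℂ) ^ (i / 2) * ((i / 2).factorial : ℂ))⁻¹ *
    ∑ σ : Equiv.Perm (Fin i), ((Equiv.Perm.sign σ : ℤ) : ℂ) *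
      ∏ k : Fin (i / 2), M (σ ⟨2 * (k : ℕ), by omega⟩) (σ ⟨2 * (k : ℕ) + 1, by omega⟩)

/-- The number of standard generators of the ring of invariant polynomials on `𝔤ᵢ`. -/
def numInvariants : Series → ℕ → ℕ
  | .gl, i => i
  | .so, i => i / 2

/-- The standard generators of the ring of invariant polynomials on `𝔤ᵢ`, `1 ≤ j`:
`tr (X ^ j)` for `𝔤𝔩(i)`; for `𝔰𝔬(i)`, the Pfaffian if `i = 2j`, and `tr (X ^ (2j))` otherwise. -/
noncomputable def invariant (s : Series) (i j : ℕ) (X : g s i) : ℂ :=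
  match s with
  | .gl => ((X : Matrix (Fin i) (Fin i) ℂ) ^ j).trace
  | .so =>
    if i = 2 * j then pfaffian (X : Matrix (Fin i) (Fin i) ℂ)
    else ((X : Matrix (Fin i) (Fin i) ℂ) ^ (2 * j)).trace

/-- The index set of all pairs `(i, j)` with `1 ≤ i ≤ n` and `1 ≤ j ≤ rᵢ`. -/
def Index (s : Series) (n : ℕ) : Type :=
  {p : ℕ × ℕ // (1 ≤ p.1 ∧ p.1 ≤ n) ∧ (1 ≤ p.2 ∧ p.2 ≤ numInvariants s p.1)}

/-- The function `f i j` on `𝔤ₙ`: the `j`-th generator for `𝔤ᵢ`, evaluated at the cutoff. -/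
noncomputable def f (s : Series) (n : ℕ) (p : Index s n) (x : g s n) : ℂ :=
  invariant s p.1.1 p.1.2 (cutoff x p.1.1 p.2.1.2)

/-- The differential at `x` of a (polynomial) function on `𝔤ₙ`, as the function on `𝔤ₙ` sending
`z` to the derivative of `t ↦ φ (x + t z)` at `t = 0`. -/
noncomputable def differential {s : Series} {n : ℕ} (φ : g s n → ℂ) (x : g s n) : g s n → ℂ :=
  fun z => lineDeriv ℂ φ x z

/-- `x ∈ 𝔤ₙ` is strongly regular if the differentials at `x` of all the functions `f i j`,
`1 ≤ i ≤ n`, `1 ≤ j ≤ rᵢ`, are linearly independent. -/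
def IsStronglyRegular {s : Series} {n : ℕ} (x : g s n) : Prop :=
  LinearIndependent ℂ fun p : Index s n => differential (f s n p) x

end GelfandZeitlin

/-! The trace form turns the differential of `f i j` at `x` into a gradient matrix: the gradient of
the `j`-th invariant at the cutoff `x_i`, placed in the corner (`differential_f`,
`isStronglyRegular_iff`). It lies in the centralizer 𝔷(x_i). By Kostant's criterion
(`linearIndependent_invariantGrad_iff`) the gradients of level `i` are independent exactly when
`x_i` is regular, and then they form a basis of 𝔷(x_i). So strong regularity means (a) together with
directness of the sum of all 𝔷(x_i). Directness gives (b) at once. Conversely (b) suffices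
(`eq_zero_of_sum_eq_zero`): in a vanishing sum, the top term, of level `m`, is supported in the
`(m-1)`-corner, hence lies in 𝔷(x_{m-1}) as well as in 𝔷(x_m).

Kostant's criterion is proved by linear algebra, through the degree `d` of the minimal polynomial of
`y`. For 𝔤𝔩(n) both sides say `d = n`. For 𝔰𝔬(n) the centralizer has dimension at least `n - ⌈d/2⌉`,
with equality if `d ≥ n - 1`, so `y` is regular iff `d = n`, or `d = n - 1` with `n` even. On the
side of the gradients, the odd powers of `y` are controlled by the parity of the minimal polynomial,
and the Pfaffian gradient `P` by `y P = (Pf y / 2) • 1` and by `P ≠ 0` when `y` has corank at most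
2. -/

namespace GelfandZeitlin

open Matrix Polynomial

/-! ### Vectors whose annihilator is the minimal polynomial. -/

section Cyclic

variable {n : ℕ}

/-- With `m` the minimal polynomial, a suitable `v` is one outside the kernels of `(m / (X -
a))(y)`, `a` a root of `m`: these are finitely many proper subspaces. If `gcd(p, m)` were a proper
divisor of `m`, it would divide some `m / (X - a)`, which would then kill `v`. -/
theorem exists_cyclic_vector (y : Matrix (Fin n) (Fin n) ℂ) :
    ∃ v : Fin n → ℂ, ∀ p : ℂ[X], aeval y p *ᵥ v = 0 → minpoly ℂ y ∣ p := by
  classical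
  have hint : IsIntegral ℂ y := Algebra.IsIntegral.isIntegral y
  set m := minpoly ℂ y with hm
  have hm0 : m ≠ 0 := minpoly.ne_zero hint
  let K : ℂ → Submodule ℂ (Fin n → ℂ) := fun a => LinearMap.ker (mulVecLin (aeval y (m /ₘ (X - C a))))
  have hK : ∀ a ∈ m.roots.toFinset, K a ≠ ⊤ := by
    intro a ha htop
    have ha' : m.IsRoot a := by simpa [hm0] using ha
    have hdiv : (X - C a) * (m /ₘ (X - C a)) = m := mul_divByMonic_eq_iff_isRoot.2 ha'
    have hz : aeval y (m /ₘ (X - C a)) = 0 := by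
      have h := LinearMap.ker_eq_top.1 htop
      ext i j
      have := congrFun (LinearMap.congr_fun h (Pi.single j 1)) i
      simpa using this
    have hne : m /ₘ (X - C a) ≠ 0 := by
      intro h; rw [h, mul_zero] at hdiv; exact hm0 hdiv.symm
    have hdeg := natDegree_le_natDegree (minpoly.degree_le_of_ne_zero ℂ y hne hz)
    rw [← hm] at hdeg
    have := congrArg natDegree hdiv
    rw [natDegree_mul (X_sub_C_ne_zero a) hne, natDegree_X_sub_C] at this
    omega
  have hcov := Subspace.biUnion_ne_univ_of_top_notMem (k := ℂ) (E := Fin n → ℂ)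
    (s := m.roots.toFinset.image K) (by
      intro h
      obtain ⟨a, ha, h⟩ := Finset.mem_image.1 h
      exact hK a ha h)
  obtain ⟨v, hv⟩ := (Set.ne_univ_iff_exists_notMem _).1 hcov
  refine ⟨v, fun p hp => ?_⟩
  have hgm : aeval y (gcd p m) *ᵥ v = 0 := by
    obtain ⟨a, b, hab⟩ := exists_gcd_eq_mul_add_mul p m
    rw [hab, mul_comm p a, map_add, map_mul, map_mul, hm, minpoly.aeval, zero_mul, add_zero,
      ← mulVec_mulVec, hp, mulVec_zero]
  obtain ⟨h, hh⟩ := gcd_dvd_right p m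
  by_cases hdeg : h.degree = 0
  · have hu : IsUnit h := isUnit_iff_degree_eq_zero.2 hdeg
    have : Associated (gcd p m) m := ⟨hu.unit, hh.symm⟩
    exact this.symm.dvd.trans (gcd_dvd_left p m)
  · exfalso
    obtain ⟨a, ha⟩ := IsAlgClosed.exists_root h hdeg
    obtain ⟨q, rfl⟩ := dvd_iff_isRoot.2 ha
    have hroot : m.IsRoot a := by
      rw [← dvd_iff_isRoot, hh]; exact ⟨gcd p m * q, by ring⟩
    have hdiv : (X - C a) * (m /ₘ (X - C a)) = m := mul_divByMonic_eq_iff_isRoot.2 hroot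
    have hq : m /ₘ (X - C a) = q * gcd p m := by
      apply mul_left_cancel₀ (X_sub_C_ne_zero a)
      rw [hdiv]; conv_lhs => rw [hh]
      ring
    apply hv
    refine Set.mem_iUnion₂.2 ⟨K a, ?_, ?_⟩
    · exact Finset.mem_image_of_mem _ (by simpa [hm0] using hroot)
    · change v ∈ K a
      rw [LinearMap.mem_ker, mulVecLin_apply, hq, map_mul, ← mulVec_mulVec, hgm, mulVec_zero]

theorem eq_zero_of_aeval_mulVec {y : Matrix (Fin n) (Fin n) ℂ} {v : Fin n → ℂ}
    (hv : ∀ p : ℂ[X], aeval y p *ᵥ v = 0 → minpoly ℂ y ∣ p) {p : ℂ[X]}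
    (hp : aeval y p *ᵥ v = 0) (hd : p.degree < (minpoly ℂ y).natDegree) : p = 0 := by
  refine eq_zero_of_dvd_of_degree_lt (hv p hp) ?_
  rwa [degree_eq_natDegree (minpoly.ne_zero (Algebra.IsIntegral.isIntegral y))]

theorem linearIndependent_pow_mulVec {y : Matrix (Fin n) (Fin n) ℂ} {v : Fin n → ℂ}
    (hv : ∀ p : ℂ[X], aeval y p *ᵥ v = 0 → minpoly ℂ y ∣ p) :
    LinearIndependent ℂ fun i : Fin (minpoly ℂ y).natDegree => y ^ (i : ℕ) *ᵥ v := by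
  rw [Fintype.linearIndependent_iff]
  intro c hc
  have h0 : (∑ i, C (c i) * X ^ (i : ℕ) : ℂ[X]) = 0 := by
    refine eq_zero_of_aeval_mulVec hv ?_ ?_
    · rw [← hc, map_sum, Matrix.sum_mulVec]
      refine Finset.sum_congr rfl fun i _ => ?_
      rw [map_mul, aeval_C, map_pow, aeval_X, ← smul_mulVec, Algebra.smul_def]
    · refine (degree_sum_le _ _).trans_lt ?_
      refine (Finset.sup_lt_iff (WithBot.bot_lt_coe _)).2 fun i _ => ?_
      exact (degree_C_mul_X_pow_le _ _).trans_lt (by exact_mod_cast i.2)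
  intro i
  have := congrArg (fun p => coeff p (i : ℕ)) h0
  simpa [finsetSum_coeff, coeff_X_pow, Fin.val_inj] using this

theorem natDegree_minpoly_le (y : Matrix (Fin n) (Fin n) ℂ) : (minpoly ℂ y).natDegree ≤ n := by
  obtain ⟨v, hv⟩ := exists_cyclic_vector y
  simpa using (linearIndependent_pow_mulVec hv).fintype_card_le_finrank

/-- A cyclic vector of maximal annihilator splits off: if `minpoly y` kills `z`, there is a map of
`ℂ[X]`-modules sending `v` to `1`, where `X` acts by `y` on the source and by `z` on the target. -/
theorem exists_splitting {y : Matrix (Fin n) (Fin n) ℂ} {v : Fin n → ℂ}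
    (hv : ∀ p : ℂ[X], aeval y p *ᵥ v = 0 → minpoly ℂ y ∣ p) (z : Matrix (Fin n) (Fin n) ℂ)
    (hz : aeval z (minpoly ℂ y) = 0) (hn : 0 < n) :
    ∃ c : (Fin n → ℂ) →ₗ[ℂ] Matrix (Fin n) (Fin n) ℂ,
      c v = 1 ∧ (∀ w, c (y *ᵥ w) = z * c w) ∧
      ∀ w, ∃ a : ℕ → ℂ, c w = ∑ k ∈ Finset.range (minpoly ℂ y).natDegree, a k • z ^ k := by
  have hint : IsIntegral ℂ y := Algebra.IsIntegral.isIntegral y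
  set m := minpoly ℂ y with hm
  set d := m.natDegree with hd
  have : Nonempty (Fin n) := ⟨⟨0, hn⟩⟩
  have hd0 : 0 < d := minpoly.natDegree_pos hint
  obtain ⟨L, hL⟩ := LinearMap.exists_leftInverse_of_injective
    (Fintype.linearCombination ℂ fun i : Fin d => y ^ (i : ℕ) *ᵥ v)
    (LinearMap.ker_eq_bot.2 (linearIndependent_iff_injective_fintypeLinearCombination.1 (linearIndependent_pow_mulVec hv)))
  -- On the cyclic subspace, `l` reads off the coefficient of `y ^ (d - 1) *ᵥ v`.
  let l : (Fin n → ℂ) →ₗ[ℂ] ℂ := LinearMap.proj ⟨d - 1, by omega⟩ ∘ₗ L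
  have hl : ∀ i < d, l (y ^ i *ᵥ v) = if i = d - 1 then 1 else 0 := by
    intro i hi
    have h := LinearMap.congr_fun hL (Pi.single ⟨i, hi⟩ 1)
    have h2 : L (y ^ i *ᵥ v) = Pi.single (⟨i, hi⟩ : Fin d) (1 : ℂ) := by
      simpa [Fintype.linearCombination_apply_single] using h
    simp only [l, LinearMap.comp_apply, LinearMap.proj_apply, h2, Pi.single_apply, Fin.mk.injEq]
    simp [eq_comm]
  -- This is the difference quotient `(m(z) - m(y)) / (z - y)`, with `l` applied to the `y`-part.
  -- Intertwining is a telescoping sum whose ends vanish because `m(y) = 0` and `m(z) = 0`; at `v`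
  -- only the term `j = d`, `k = 0` survives.
  let c : (Fin n → ℂ) →ₗ[ℂ] Matrix (Fin n) (Fin n) ℂ :=
    ∑ j ∈ Finset.range (d + 1), m.coeff j • ∑ k ∈ Finset.range j,
      (l ∘ₗ mulVecLin (y ^ (j - 1 - k))).smulRight (z ^ k)
  have hc : ∀ w, c w = ∑ j ∈ Finset.range (d + 1), m.coeff j • ∑ k ∈ Finset.range j,
      l (y ^ (j - 1 - k) *ᵥ w) • z ^ k := by
    intro w; simp [c, LinearMap.sum_apply]
  refine ⟨c, ?_, ?_, ?_⟩
  · rw [hc, Finset.sum_range_succ, Finset.sum_eq_zero, zero_add]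
    · rw [hd, (minpoly.monic hint).coeff_natDegree, one_smul, ← hd,
        Finset.sum_eq_single_of_mem 0 (Finset.mem_range.2 hd0)]
      · rw [hl _ (by omega)]; simp
      · intro k hk hk0
        rw [Finset.mem_range] at hk
        rw [hl _ (by omega), if_neg (by omega), zero_smul]
    · intro j hj
      rw [Finset.mem_range] at hj
      rw [Finset.sum_eq_zero, smul_zero]
      intro k hk
      rw [Finset.mem_range] at hk
      rw [hl _ (by omega), if_neg (by omega), zero_smul]
  · intro w
    have tele : ∀ j, (∑ k ∈ Finset.range j, l (y ^ (j - 1 - k) *ᵥ (y *ᵥ w)) • z ^ k) -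
        z * (∑ k ∈ Finset.range j, l (y ^ (j - 1 - k) *ᵥ w) • z ^ k) =
        l (y ^ j *ᵥ w) • 1 - l w • z ^ j := by
      intro j
      rw [Finset.mul_sum, ← Finset.sum_sub_distrib]
      have : ∀ k ∈ Finset.range j, l (y ^ (j - 1 - k) *ᵥ (y *ᵥ w)) • z ^ k -
          z * l (y ^ (j - 1 - k) *ᵥ w) • z ^ k =
          l (y ^ (j - k) *ᵥ w) • z ^ k - l (y ^ (j - (k + 1)) *ᵥ w) • z ^ (k + 1) := by
        intro k hk
        rw [Finset.mem_range] at hk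
        rw [mulVec_mulVec, ← pow_succ, mul_smul_comm, ← pow_succ',
          show j - 1 - k + 1 = j - k by omega, show j - 1 - k = j - (k + 1) by omega]
      rw [Finset.sum_congr rfl this, Finset.sum_range_sub' (fun k => l (y ^ (j - k) *ᵥ w) • z ^ k)]
      simp
    rw [← sub_eq_zero, hc, hc, Finset.mul_sum, ← Finset.sum_sub_distrib]
    simp_rw [mul_smul_comm, ← smul_sub, tele]
    have h1 : aeval y m *ᵥ w = 0 := by rw [hm, minpoly.aeval, zero_mulVec]
    rw [aeval_eq_sum_range, Matrix.sum_mulVec] at h1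
    rw [aeval_eq_sum_range] at hz
    have h2 := congrArg l h1
    rw [map_sum, map_zero] at h2
    simp_rw [smul_sub, Finset.sum_sub_distrib, smul_smul]
    rw [← Finset.sum_smul]
    have h3 : ∑ j ∈ Finset.range (d + 1), m.coeff j * l (y ^ j *ᵥ w) = 0 := by
      rw [← h2]; refine Finset.sum_congr rfl fun j _ => ?_
      rw [smul_mulVec, map_smul, smul_eq_mul]
    have h4 : ∑ j ∈ Finset.range (d + 1), (m.coeff j * l w) • z ^ j = 0 := by
      simp_rw [mul_comm _ (l w), mul_smul]
      rw [← Finset.smul_sum, hz, smul_zero]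
    rw [h3, h4, zero_smul, sub_zero]
  · intro w
    refine ⟨fun k => ∑ j ∈ Finset.range (d + 1), if k < j then m.coeff j * l (y ^ (j - 1 - k) *ᵥ w) else 0, ?_⟩
    rw [hc]
    simp_rw [Finset.sum_smul]
    rw [Finset.sum_comm]
    refine Finset.sum_congr rfl fun j hj => ?_
    rw [Finset.mem_range] at hj
    rw [Finset.smul_sum]
    have hsub : Finset.range j ⊆ Finset.range d := Finset.range_subset_range.2 (by omega)
    rw [← Finset.sum_subset hsub]
    · refine Finset.sum_congr rfl fun k hk => ?_
      rw [if_pos (Finset.mem_range.1 hk), mul_smul]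
    · intro k _ hk
      rw [if_neg (by simpa using hk), zero_smul]

end Cyclic

end GelfandZeitlin

namespace GelfandZeitlin

open Matrix Polynomial Module

/-! ### Dimension of the centralizer in terms of the degree of the minimal polynomial. -/

section Commutant

variable {n : ℕ}

theorem mem_g_so {a : Matrix (Fin n) (Fin n) ℂ} : a ∈ g .so n ↔ aᵀ = -a :=
  LieAlgebra.Orthogonal.mem_so (Fin n) ℂ a

theorem mem_g_gl (a : Matrix (Fin n) (Fin n) ℂ) : a ∈ g .gl n := LieSubalgebra.mem_top _

/-- The matrices of `𝔤ₙ` commuting with `y`. -/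
def commutant (s : Series) (y : Matrix (Fin n) (Fin n) ℂ) :
    Submodule ℂ (Matrix (Fin n) (Fin n) ℂ) where
  carrier := {a | a ∈ g s n ∧ y * a = a * y}
  zero_mem' := ⟨zero_mem _, by simp⟩
  add_mem' ha hb := ⟨add_mem ha.1 hb.1, by rw [mul_add, add_mul, ha.2, hb.2]⟩
  smul_mem' c _ ha := ⟨(g s n).smul_mem c ha.1, by rw [mul_smul_comm, smul_mul_assoc, ha.2]⟩

theorem aeval_transpose (y : Matrix (Fin n) (Fin n) ℂ) (p : ℂ[X]) :
    aeval yᵀ p = (aeval y p)ᵀ := by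
  rw [aeval_eq_sum_range, aeval_eq_sum_range, transpose_sum]
  simp [transpose_pow]

theorem aeval_neg_minpoly {y : Matrix (Fin n) (Fin n) ℂ} (hy : yᵀ = -y) :
    aeval (-y) (minpoly ℂ y) = 0 := by
  rw [← hy, aeval_transpose, minpoly.aeval, transpose_zero]

theorem commute_pow_of_commute {y a : Matrix (Fin n) (Fin n) ℂ} (h : y * a = a * y) (k : ℕ) :
    y ^ k * a = a * y ^ k :=
  (show Commute y a from h).pow_left k

theorem exists_finrank_sup_span_singleton (W : Submodule ℂ (Fin n → ℂ)) :
    ∃ u : Fin n → ℂ, min n (finrank ℂ W + 1) ≤ finrank ℂ ↥(W ⊔ Submodule.span ℂ {u}) := by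
  by_cases htop : W = ⊤
  · refine ⟨0, ?_⟩
    rw [htop, top_sup_eq, finrank_top, finrank_fin_fun]
    exact min_le_left _ _
  · obtain ⟨u, hu⟩ : ∃ u, u ∉ W := by
      by_contra! h
      exact htop (eq_top_iff.2 fun u _ => h u)
    refine ⟨u, (min_le_right _ _).trans (Submodule.finrank_lt_finrank_of_lt ?_)⟩
    refine lt_of_le_of_ne le_sup_left fun h => hu ?_
    rw [h]
    exact Submodule.mem_sup_right (Submodule.mem_span_singleton_self u)

theorem exists_span_pow_mulVec_sup_eq_top {y : Matrix (Fin n) (Fin n) ℂ} {v : Fin n → ℂ}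
    (hv : ∀ p : ℂ[X], aeval y p *ᵥ v = 0 → minpoly ℂ y ∣ p)
    (hd : n ≤ (minpoly ℂ y).natDegree + 1) :
    ∃ u : Fin n → ℂ,
      Submodule.span ℂ (Set.range fun i : Fin (minpoly ℂ y).natDegree => y ^ (i : ℕ) *ᵥ v) ⊔
        Submodule.span ℂ {u} = ⊤ := by
  obtain ⟨u, hu⟩ := exists_finrank_sup_span_singleton (Submodule.span ℂ
    (Set.range fun i : Fin (minpoly ℂ y).natDegree => y ^ (i : ℕ) *ᵥ v))
  refine ⟨u, Submodule.eq_top_of_finrank_eq (le_antisymm (Submodule.finrank_le _) ?_)⟩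
  rw [finrank_span_eq_card (linearIndependent_pow_mulVec hv), Fintype.card_fin,
    min_eq_left hd] at hu
  rwa [finrank_fin_fun]

theorem mulVec_eq_zero_of_mem_span_pow {y a : Matrix (Fin n) (Fin n) ℂ} {v : Fin n → ℂ}
    (h : y * a = a * y) (hav : a *ᵥ v = 0) {w : Fin n → ℂ} {d : ℕ}
    (hw : w ∈ Submodule.span ℂ (Set.range fun i : Fin d => y ^ (i : ℕ) *ᵥ v)) :
    a *ᵥ w = 0 := by
  have : Submodule.span ℂ (Set.range fun i : Fin d => y ^ (i : ℕ) *ᵥ v) ≤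
      LinearMap.ker (mulVecLin a) := by
    rw [Submodule.span_le]
    rintro _ ⟨i, rfl⟩
    change a *ᵥ (y ^ (i : ℕ) *ᵥ v) = 0
    rw [mulVec_mulVec, ← commute_pow_of_commute h, ← mulVec_mulVec, hav, mulVec_zero]
  exact this hw

theorem finrank_commutant_gl_of_eq {y : Matrix (Fin n) (Fin n) ℂ}
    (hd : (minpoly ℂ y).natDegree = n) : finrank ℂ (commutant .gl y) = n := by
  obtain ⟨v, hv⟩ := exists_cyclic_vector y
  have hli := linearIndependent_pow_mulVec hv
  have hspan : Submodule.span ℂ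
      (Set.range fun i : Fin (minpoly ℂ y).natDegree => y ^ (i : ℕ) *ᵥ v) = ⊤ :=
    Submodule.eq_top_of_finrank_eq (by
      rw [finrank_span_eq_card hli, Fintype.card_fin, finrank_fin_fun, hd])
  apply le_antisymm
  · let T : commutant .gl y →ₗ[ℂ] (Fin n → ℂ) :=
      ((mulVecBilin ℂ ℂ).flip v) ∘ₗ (commutant .gl y).subtype
    have hT : Function.Injective T := by
      rw [injective_iff_map_eq_zero]
      rintro ⟨a, ha⟩ h
      have h' : a *ᵥ v = 0 := h
      ext i j
      have := mulVec_eq_zero_of_mem_span_pow ha.2 h' (w := Pi.single j 1) (hspan ▸ Submodule.mem_top)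
      simpa using congrFun this i
    simpa using LinearMap.finrank_le_finrank_of_injective hT
  · have hpow : LinearIndependent ℂ fun i : Fin (minpoly ℂ y).natDegree =>
        (⟨y ^ (i : ℕ), mem_g_gl _, by rw [← pow_succ, ← pow_succ']⟩ : commutant .gl y) := by
      let T : commutant .gl y →ₗ[ℂ] (Fin n → ℂ) :=
        ((mulVecBilin ℂ ℂ).flip v) ∘ₗ (commutant .gl y).subtype
      exact LinearIndependent.of_comp T hli
    simpa [hd] using hpow.fintype_card_le_finrank

/-- With the splitting `c` for `z = y`, the maps `w ↦ c w *ᵥ u` commute with `y` and form an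
`n`-dimensional space, since `c v = 1` recovers `u`. The identity is not among them: otherwise the
`d < n` vectors `y ^ k *ᵥ u` would span everything. -/
theorem lt_finrank_commutant_gl {y : Matrix (Fin n) (Fin n) ℂ}
    (hd : (minpoly ℂ y).natDegree < n) : n < finrank ℂ (commutant .gl y) := by
  obtain ⟨v, hv⟩ := exists_cyclic_vector y
  obtain ⟨c, hc1, hcy, hc⟩ := exists_splitting hv y (minpoly.aeval ℂ y) (by omega)
  let A : (Fin n → ℂ) →ₗ[ℂ] Matrix (Fin n) (Fin n) ℂ :=
    { toFun := fun u => LinearMap.toMatrix' (((mulVecBilin ℂ ℂ).flip u) ∘ₗ c)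
      map_add' := by intro u w; rw [map_add, LinearMap.add_comp, map_add]
      map_smul' := by intro r u; rw [map_smul, LinearMap.smul_comp, map_smul]; rfl }
  have hA : ∀ u w, A u *ᵥ w = c w *ᵥ u := by
    intro u w
    change LinearMap.toMatrix' (((mulVecBilin ℂ ℂ).flip u) ∘ₗ c) *ᵥ w = _
    rw [← toLin'_apply, toLin'_toMatrix']
    rfl
  have hAcomm : ∀ u, A u ∈ commutant .gl y := by
    intro u
    refine ⟨mem_g_gl _, ?_⟩
    apply ext_of_mulVec_single
    intro j
    rw [← mulVec_mulVec, ← mulVec_mulVec, hA, hA, hcy, mulVec_mulVec]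
  have hAinj : Function.Injective A := by
    rw [injective_iff_map_eq_zero]
    intro u hu
    have := hA u v
    rwa [hu, hc1, zero_mulVec, one_mulVec, eq_comm] at this
  have hrange : LinearMap.range A < commutant .gl y := by
    refine lt_of_le_of_ne ?_ ?_
    · rintro _ ⟨u, rfl⟩; exact hAcomm u
    · intro h
      have h1 : (1 : Matrix (Fin n) (Fin n) ℂ) ∈ commutant .gl y := ⟨mem_g_gl _, by simp⟩
      rw [← h] at h1
      obtain ⟨u, hu⟩ := h1
      have hw : ∀ w, w = c w *ᵥ u := fun w => by rw [← hA, hu, one_mulVec]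
      have hspan : (⊤ : Submodule ℂ (Fin n → ℂ)) ≤ Submodule.span ℂ
          (Set.range fun i : Fin (minpoly ℂ y).natDegree => y ^ (i : ℕ) *ᵥ u) := by
        intro w _
        obtain ⟨a, ha⟩ := hc w
        rw [hw w, ha, sum_mulVec]
        refine Submodule.sum_mem _ fun k hk => ?_
        rw [smul_mulVec]
        exact Submodule.smul_mem _ _ (Submodule.subset_span ⟨⟨k, Finset.mem_range.1 hk⟩, rfl⟩)
      have h2 := finrank_range_le_card (R := ℂ)
        (fun i : Fin (minpoly ℂ y).natDegree => y ^ (i : ℕ) *ᵥ u)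
      rw [Set.finrank, top_le_iff.1 hspan, finrank_top, finrank_fin_fun, Fintype.card_fin] at h2
      omega
  have h := Submodule.finrank_lt_finrank_of_lt hrange
  rwa [LinearMap.finrank_range_of_inj hAinj, finrank_fin_fun] at h

/-- The splitting is used with `z = -y`, which has the same minimal polynomial as its transpose `y`.
Antisymmetrizing `μ ⬝ᵥ (c u *ᵥ w)` in `u`, `w` gives alternating forms for which `y` is skew, that
is, elements of the centralizer, parametrized linearly by `μ`. -/
theorem le_finrank_commutant_so {y : Matrix (Fin n) (Fin n) ℂ} (hy : yᵀ = -y) :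
    n - ((minpoly ℂ y).natDegree + 1) / 2 ≤ finrank ℂ (commutant .so y) := by
  rcases Nat.eq_zero_or_pos n with rfl | hn
  · simp
  obtain ⟨v, hv⟩ := exists_cyclic_vector y
  obtain ⟨c, hc1, hcy, hc⟩ := exists_splitting hv (-y) (aeval_neg_minpoly hy) hn
  set d := (minpoly ℂ y).natDegree with hd
  let β : (Fin n → ℂ) → (Fin n → ℂ) → (Fin n → ℂ) → ℂ := fun μ u w =>
    μ ⬝ᵥ (c u *ᵥ w) - μ ⬝ᵥ (c w *ᵥ u)
  let A : (Fin n → ℂ) →ₗ[ℂ] Matrix (Fin n) (Fin n) ℂ :=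
    { toFun := fun μ => Matrix.of fun i j => β μ (Pi.single i 1) (Pi.single j 1)
      map_add' := by intro u w; ext i j; simp only [β, of_apply, Matrix.add_apply, add_dotProduct]; ring
      map_smul' := by
        intro r u; ext i j
        simp only [β, of_apply, Matrix.smul_apply, smul_dotProduct, RingHom.id_apply, smul_eq_mul]; ring }
  have hA : ∀ μ u w, u ⬝ᵥ (A μ *ᵥ w) = β μ u w := by
    intro μ
    let B : (Fin n → ℂ) →ₗ[ℂ] (Fin n → ℂ) →ₗ[ℂ] ℂ :=
      LinearMap.mk₂ ℂ (β μ)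
        (by intro a b w; simp only [β, map_add, add_mulVec, mulVec_add, dotProduct_add]; ring)
        (by intro a b w; simp only [β, map_smul, smul_mulVec, mulVec_smul, dotProduct_smul,
              smul_eq_mul]; ring)
        (by intro a b w; simp only [β, map_add, add_mulVec, mulVec_add, dotProduct_add]; ring)
        (by intro a b w; simp only [β, map_smul, smul_mulVec, mulVec_smul, dotProduct_smul,
              smul_eq_mul]; ring)
    intro u w
    have h2 := Matrix.toLinearMap₂'_apply' (A μ) u w
    rw [← h2]
    have h3 : A μ = LinearMap.toMatrix₂' ℂ B := by
      ext i j; rw [LinearMap.toMatrix₂'_apply]; rfl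
    rw [h3, Matrix.toLinearMap₂'_toMatrix']
    rfl
  have hskew : ∀ μ, (A μ)ᵀ = -A μ := by
    intro μ; ext i j
    simp [A, β]
  have hβ : ∀ μ u w, β μ (y *ᵥ u) w = -β μ u (y *ᵥ w) := by
    intro μ u w
    have hcu : y * c u = c u * y := by
      obtain ⟨a, ha⟩ := hc u
      rw [ha, Finset.mul_sum, Finset.sum_mul]
      refine Finset.sum_congr rfl fun k _ => ?_
      rw [mul_smul_comm, smul_mul_assoc, ((Commute.refl y).neg_right.pow_right k).eq]
    have hcw : y * c w = c w * y := by
      obtain ⟨a, ha⟩ := hc w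
      rw [ha, Finset.mul_sum, Finset.sum_mul]
      refine Finset.sum_congr rfl fun k _ => ?_
      rw [mul_smul_comm, smul_mul_assoc, ((Commute.refl y).neg_right.pow_right k).eq]
    simp only [β, hcy, neg_mul, neg_mulVec, dotProduct_neg, hcu, hcw, mulVec_mulVec]
    ring
  have hcomm : ∀ μ, A μ ∈ commutant .so y := by
    intro μ
    refine ⟨mem_g_so.2 (hskew μ), ?_⟩
    ext i j
    have h := hβ μ (Pi.single i 1) (Pi.single j 1)
    rw [← hA, ← hA, mulVec_mulVec] at h
    have h2 : (y *ᵥ Pi.single i 1) ⬝ᵥ (A μ *ᵥ Pi.single j 1) =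
        -(Pi.single i 1 ⬝ᵥ (y * A μ) *ᵥ Pi.single j 1) := by
      rw [dotProduct_comm, dotProduct_mulVec, ← mulVec_transpose, hy, ← mulVec_mulVec, neg_mulVec, neg_dotProduct, dotProduct_comm]
    rw [h2] at h
    simpa using neg_injective h
  -- If the form of `μ` vanishes, then `μ ⬝ᵥ w = μ ⬝ᵥ (c w *ᵥ v)`. At `w = y ^ k *ᵥ v` this kills
  -- the odd moments of `μ`, so the `⌈d/2⌉` even moments below `d` determine `μ`.
  have hker : finrank ℂ (LinearMap.ker A) ≤ (d + 1) / 2 := by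
    let T : (Fin n → ℂ) →ₗ[ℂ] (Fin ((d + 1) / 2) → ℂ) :=
      { toFun := fun μ k => μ ⬝ᵥ (y ^ (2 * (k : ℕ)) *ᵥ v)
        map_add' := by intro u w; ext k; simp [add_dotProduct]
        map_smul' := by intro r u; ext k; simp [smul_dotProduct] }
    have hT : Function.Injective (T ∘ₗ (LinearMap.ker A).subtype) := by
      rw [injective_iff_map_eq_zero]
      rintro ⟨μ, hμ⟩ h
      have hμ0 : ∀ w, μ ⬝ᵥ w = μ ⬝ᵥ (c w *ᵥ v) := by
        intro w
        have h1 := hA μ v w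
        rw [LinearMap.mem_ker.1 hμ, zero_mulVec, dotProduct_zero] at h1
        simp only [β, hc1, one_mulVec] at h1
        exact (sub_eq_zero.1 h1.symm)
      have hcpow : ∀ k, c (y ^ k *ᵥ v) = (-y) ^ k := by
        intro k
        induction k with
        | zero => simp [hc1]
        | succ k ih => rw [pow_succ', ← mulVec_mulVec, hcy, ih, ← pow_succ']
      have hpow : ∀ k < d, μ ⬝ᵥ (y ^ k *ᵥ v) = 0 := by
        intro k hk
        rcases Nat.even_or_odd' k with ⟨j, rfl | rfl⟩
        · exact congrFun h ⟨j, by omega⟩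
        · have h1 := hμ0 (y ^ (2 * j + 1) *ᵥ v)
          rw [hcpow, Odd.neg_pow ⟨j, rfl⟩, neg_mulVec, dotProduct_neg] at h1
          exact self_eq_neg.1 h1
      have hall : ∀ w, μ ⬝ᵥ w = 0 := by
        intro w
        obtain ⟨a, ha⟩ := hc w
        rw [hμ0, ha, sum_mulVec, dotProduct_sum]
        refine Finset.sum_eq_zero fun k hk => ?_
        rw [smul_mulVec, dotProduct_smul, neg_pow, ← mulVec_mulVec]
        have : (-1 : Matrix (Fin n) (Fin n) ℂ) ^ k = ((-1 : ℂ) ^ k) • 1 := by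
          rw [← neg_one_smul ℂ (1 : Matrix (Fin n) (Fin n) ℂ), _root_.smul_pow, one_pow]
        rw [this, smul_mulVec, one_mulVec, dotProduct_smul, hpow k (Finset.mem_range.1 hk)]
        simp
      ext i
      simpa using hall (Pi.single i 1)
    simpa using LinearMap.finrank_le_finrank_of_injective hT
  have hrange : LinearMap.range A ≤ commutant .so y := by
    rintro _ ⟨u, rfl⟩; exact hcomm u
  have h1 := Submodule.finrank_mono hrange
  have h2 := LinearMap.finrank_range_add_finrank_ker A
  rw [finrank_fin_fun] at h2
  omega

/-- The map `a ↦ a *ᵥ v` is injective: if `a` kills `v` it kills the cyclic subspace, of codimension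
at most 1, and an alternating form with so large a radical is zero. Its image is orthogonal to the
`⌈d/2⌉` independent vectors `y ^ (2k) *ᵥ v`. -/
theorem finrank_commutant_so_le {y : Matrix (Fin n) (Fin n) ℂ}
    (hd : n ≤ (minpoly ℂ y).natDegree + 1) (hy : yᵀ = -y) :
    finrank ℂ (commutant .so y) ≤ n - ((minpoly ℂ y).natDegree + 1) / 2 := by
  obtain ⟨v, hv⟩ := exists_cyclic_vector y
  have hli := linearIndependent_pow_mulVec hv
  obtain ⟨u, hu⟩ := exists_span_pow_mulVec_sup_eq_top hv hd
  set d := (minpoly ℂ y).natDegree with hd'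
  let M : Matrix (Fin ((d + 1) / 2)) (Fin n) ℂ := Matrix.of fun k => y ^ (2 * (k : ℕ)) *ᵥ v
  have hM : LinearIndependent ℂ M.row := by
    have := hli.comp (fun k : Fin ((d + 1) / 2) => (⟨2 * k, by omega⟩ : Fin d))
      (by intro i j h; simp only [Fin.mk.injEq] at h; omega)
    exact this
  have hrank := hM.rank_matrix
  rw [Fintype.card_fin] at hrank
  have hker : finrank ℂ (LinearMap.ker M.mulVecLin) = n - (d + 1) / 2 := by
    have := LinearMap.finrank_range_add_finrank_ker M.mulVecLin
    rw [finrank_fin_fun] at this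
    rw [Matrix.rank] at hrank
    omega
  rw [← hker]
  let T : commutant .so y →ₗ[ℂ] LinearMap.ker M.mulVecLin :=
    LinearMap.codRestrict _ (((mulVecBilin ℂ ℂ).flip v) ∘ₗ (commutant .so y).subtype) (by
      rintro ⟨a, ha, hya⟩
      rw [LinearMap.mem_ker]
      ext k
      change (y ^ (2 * (k : ℕ)) *ᵥ v) ⬝ᵥ (a *ᵥ v) = 0
      have hskew : ∀ w, w ⬝ᵥ (a *ᵥ w) = 0 := by
        intro w
        have h1 : w ⬝ᵥ (a *ᵥ w) = -(w ⬝ᵥ (a *ᵥ w)) := by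
          conv_lhs => rw [dotProduct_mulVec, ← mulVec_transpose, mem_g_so.1 ha, neg_mulVec,
            neg_dotProduct, dotProduct_comm]
        exact self_eq_neg.1 h1
      -- Half of the power moves across the dot product, leaving the alternating form of `a` at the
      -- pair `(y ^ k *ᵥ v, y ^ k *ᵥ v)`.
      have h2 : y ^ (2 * (k : ℕ)) = (-1 : ℂ) ^ (k : ℕ) • ((y ^ (k : ℕ))ᵀ * y ^ (k : ℕ)) := by
        rw [transpose_pow, hy, ← neg_one_smul ℂ y, _root_.smul_pow, smul_mul_assoc, ← pow_add,
          ← two_mul, smul_smul, ← mul_pow]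
        simp
      rw [h2, smul_mulVec, smul_dotProduct, ← mulVec_mulVec, mulVec_transpose,
        ← dotProduct_mulVec, mulVec_mulVec, commute_pow_of_commute hya, ← mulVec_mulVec, hskew,
        smul_zero])
  have hT : Function.Injective T := by
    rw [injective_iff_map_eq_zero]
    rintro ⟨a, ha, hya⟩ h
    have hav : a *ᵥ v = 0 := congrArg Subtype.val h
    have hflip : ∀ w w', w ⬝ᵥ (a *ᵥ w') = -(w' ⬝ᵥ (a *ᵥ w)) := by
      intro w w'
      rw [dotProduct_mulVec, ← mulVec_transpose, mem_g_so.1 ha, neg_mulVec,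
        neg_dotProduct, dotProduct_comm]
    have hW : ∀ w ∈ Submodule.span ℂ (Set.range fun i : Fin d => y ^ (i : ℕ) *ᵥ v), a *ᵥ w = 0 :=
      fun w hw => mulVec_eq_zero_of_mem_span_pow hya hav hw
    have hall : ∀ w w', w ⬝ᵥ (a *ᵥ w') = 0 := by
      intro w w'
      obtain ⟨p, hp, q, hq, rfl⟩ := Submodule.mem_sup.1 (hu ▸ Submodule.mem_top : w ∈ _)
      obtain ⟨p', hp', q', hq', rfl⟩ := Submodule.mem_sup.1 (hu ▸ Submodule.mem_top : w' ∈ _)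
      obtain ⟨r, rfl⟩ := Submodule.mem_span_singleton.1 hq
      obtain ⟨r', rfl⟩ := Submodule.mem_span_singleton.1 hq'
      have huu : u ⬝ᵥ (a *ᵥ u) = 0 := self_eq_neg.1 (hflip u u)
      rw [mulVec_add, hW _ hp', zero_add, add_dotProduct, hflip p, hW _ hp, dotProduct_zero,
        mulVec_smul, dotProduct_smul, smul_dotProduct, huu]
      simp
    ext i j
    simpa using hall (Pi.single i 1) (Pi.single j 1)
  exact LinearMap.finrank_le_finrank_of_injective hT

end Commutant

end GelfandZeitlin

namespace GelfandZeitlin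

open Matrix

/-! ### The Pfaffian: congruence, nonvanishing, derivative. -/

section Pfaffian

variable {n : ℕ}

/-- The first element of the `k`-th pair of indices. -/
def pairFst (k : Fin (n / 2)) : Fin n := ⟨2 * (k : ℕ), by omega⟩

/-- The second element of the `k`-th pair of indices. -/
def pairSnd (k : Fin (n / 2)) : Fin n := ⟨2 * (k : ℕ) + 1, by omega⟩

/-- The Pfaffian without its normalizing factor. -/
noncomputable def pfSum (M : Matrix (Fin n) (Fin n) ℂ) : ℂ :=
  ∑ σ : Equiv.Perm (Fin n), ((Equiv.Perm.sign σ : ℤ) : ℂ) *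
    ∏ k : Fin (n / 2), M (σ (pairFst k)) (σ (pairSnd k))

/-- The normalizing factor of the Pfaffian. -/
noncomputable def pfNorm (n : ℕ) : ℂ := ((2 : ℂ) ^ (n / 2) * ((n / 2).factorial : ℂ))⁻¹

theorem pfNorm_ne_zero (n : ℕ) : pfNorm n ≠ 0 :=
  inv_ne_zero (mul_ne_zero (pow_ne_zero _ two_ne_zero) (Nat.cast_ne_zero.2 (Nat.factorial_ne_zero _)))

theorem pfaffian_eq (M : Matrix (Fin n) (Fin n) ℂ) : pfaffian M = pfNorm n * pfSum M := rfl

/-- The indices grouped in pairs. -/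
def pairEquiv (hn : Even n) : Fin (n / 2) × Fin 2 ≃ Fin n where
  toFun p := ⟨2 * (p.1 : ℕ) + p.2, by omega⟩
  invFun j := (⟨(j : ℕ) / 2, by obtain ⟨l, hl⟩ := hn; omega⟩, ⟨(j : ℕ) % 2, by omega⟩)
  left_inv := by
    rintro ⟨a, b⟩
    ext
    · change (2 * (a : ℕ) + b) / 2 = a; omega
    · change (2 * (a : ℕ) + b) % 2 = b; omega
  right_inv := by
    intro j; ext; change 2 * ((j : ℕ) / 2) + (j : ℕ) % 2 = j; omega

theorem pairEquiv_zero (hn : Even n) (k : Fin (n / 2)) : pairEquiv hn (k, 0) = pairFst k := rfl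

theorem pairEquiv_one (hn : Even n) (k : Fin (n / 2)) : pairEquiv hn (k, 1) = pairSnd k := rfl

theorem prod_eq_prod_pairs (hn : Even n) (F : Fin n → ℂ) :
    ∏ j, F j = ∏ k : Fin (n / 2), F (pairFst k) * F (pairSnd k) := by
  rw [← (pairEquiv hn).prod_comp, Fintype.prod_prod_type]
  simp_rw [Fin.prod_univ_two, pairEquiv_zero, pairEquiv_one]

/-- Expanding the entries of `h * M * hᵀ`, the sum over permutations for a fixed choice `τ` of inner
indices is the determinant of `h` with columns selected by `τ`. Only the factor `h.det` depends on
`h`, so comparison with `h = 1` gives `pfaffian_congruence`. -/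
theorem pfSum_eq_sum_det (hn : Even n) (h M : Matrix (Fin n) (Fin n) ℂ) :
    pfSum (h * M * hᵀ) = h.det * ∑ τ : Fin (n / 2) → Fin n × Fin n,
      (∏ k, M (τ k).1 (τ k).2) * ((1 : Matrix (Fin n) (Fin n) ℂ).submatrix id fun j =>
        if ((pairEquiv hn).symm j).2 = 0 then (τ ((pairEquiv hn).symm j).1).1
          else (τ ((pairEquiv hn).symm j).1).2).det := by
  have hentry : ∀ a b, (h * M * hᵀ) a b =
      ∑ q : Fin n × Fin n, M q.1 q.2 * (h a q.1 * h b q.2) := by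
    intro a b
    rw [Fintype.sum_prod_type_right, mul_apply]
    refine Finset.sum_congr rfl fun j _ => ?_
    rw [mul_apply, Finset.sum_mul]
    refine Finset.sum_congr rfl fun i _ => ?_
    rw [transpose_apply]; ring
  rw [pfSum, Finset.mul_sum]
  simp_rw [hentry, Finset.prod_univ_sum, Fintype.piFinset_univ, Finset.mul_sum]
  rw [Finset.sum_comm]
  refine Finset.sum_congr rfl fun τ _ => ?_
  set τ' : Fin n → Fin n := fun j =>
    if ((pairEquiv hn).symm j).2 = 0 then (τ ((pairEquiv hn).symm j).1).1
      else (τ ((pairEquiv hn).symm j).1).2 with hτ'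
  have hsub : h.submatrix id τ' = h * (1 : Matrix (Fin n) (Fin n) ℂ).submatrix id τ' := by
    exact (Matrix.mul_submatrix_one (Equiv.refl _) τ' h).symm
  rw [mul_left_comm, ← det_mul, ← hsub, det_apply', Finset.mul_sum]
  refine Finset.sum_congr rfl fun σ _ => ?_
  rw [Finset.prod_mul_distrib, prod_eq_prod_pairs hn, mul_left_comm]
  congr 2
  refine Finset.prod_congr rfl fun k _ => ?_
  have h0 : τ' (pairFst k) = (τ k).1 := by
    simp only [hτ', ← pairEquiv_zero hn, Equiv.symm_apply_apply, if_true]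
  have h1 : τ' (pairSnd k) = (τ k).2 := by
    simp only [hτ', ← pairEquiv_one hn, Equiv.symm_apply_apply, one_ne_zero, if_false]
  simp only [submatrix_apply, id, h0, h1]

theorem pfaffian_congruence (hn : Even n) (h M : Matrix (Fin n) (Fin n) ℂ) :
    pfaffian (h * M * hᵀ) = h.det * pfaffian M := by
  have h1 := pfSum_eq_sum_det hn 1 M
  rw [det_one, one_mul, one_mul, transpose_one, mul_one] at h1
  rw [pfaffian_eq, pfaffian_eq, pfSum_eq_sum_det hn h M, ← h1]
  ring

/-- The skew-symmetric matrix with `2 × 2` diagonal blocks `!![0, c k; -c k, 0]`. -/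
def skewBlocks (n : ℕ) (c : ℕ → ℂ) : Matrix (Fin n) (Fin n) ℂ := Matrix.of fun a b =>
  if (a : ℕ) % 2 = 0 ∧ (b : ℕ) = a + 1 then c (a / 2)
  else if (b : ℕ) % 2 = 0 ∧ (a : ℕ) = b + 1 then -c (b / 2) else 0

theorem transpose_skewBlocks (n : ℕ) (c : ℕ → ℂ) : (skewBlocks n c)ᵀ = -skewBlocks n c := by
  ext a b
  simp only [skewBlocks, transpose_apply, of_apply, Matrix.neg_apply]
  split_ifs <;> first | omega | simp

theorem skewBlocks_pairEquiv (hn : Even n) (c : ℕ → ℂ) (p q : Fin (n / 2) × Fin 2) :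
    skewBlocks n c (pairEquiv hn p) (pairEquiv hn q) =
      if p.1 = q.1 ∧ p.2 ≠ q.2 then (if p.2 = 0 then c p.1 else -c p.1) else 0 := by
  obtain ⟨a, b⟩ := p
  obtain ⟨a', b'⟩ := q
  have e1 : ((pairEquiv hn (a, b) : Fin n) : ℕ) = 2 * a + b := rfl
  have e2 : ((pairEquiv hn (a', b') : Fin n) : ℕ) = 2 * a' + b' := rfl
  simp only [skewBlocks, of_apply, e1, e2]
  have hb : (b : ℕ) < 2 := b.2
  have hb' : (b' : ℕ) < 2 := b'.2
  by_cases h : a = a' ∧ b ≠ b'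
  · obtain ⟨rfl, h⟩ := h
    have hne : (b : ℕ) ≠ b' := fun h' => h (Fin.ext h')
    rw [if_pos (⟨rfl, h⟩ : a = a ∧ b ≠ b')]
    by_cases hb0 : b = 0
    · subst hb0
      simp only [Fin.val_zero] at *
      rw [if_pos (by omega), if_pos trivial]
      congr 1; omega
    · have : (b : ℕ) ≠ 0 := fun h' => hb0 (Fin.ext h')
      rw [if_neg (by omega), if_pos (by omega), if_neg hb0]
      congr 2; omega
  · rw [if_neg h]
    have h' : ¬((a : ℕ) = a' ∧ (b : ℕ) ≠ b') := fun h' => h ⟨Fin.ext h'.1, fun e => h'.2 (congrArg _ e)⟩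
    rw [if_neg (by omega), if_neg (by omega)]

theorem skewBlocks_eq_congruence (c : ℕ → ℂ) (n : ℕ) :
    skewBlocks n c = diagonal (fun j : Fin n => if (j : ℕ) % 2 = 0 then c (j / 2) else 1) *
      skewBlocks n (fun _ => 1) *
      (diagonal (fun j : Fin n => if (j : ℕ) % 2 = 0 then c (j / 2) else 1))ᵀ := by
  ext a b
  rw [diagonal_transpose, mul_diagonal, diagonal_mul]
  simp only [skewBlocks, of_apply]
  split_ifs <;> first | omega | simp

/-- A permutation of `α × Fin 2` that permutes the fibres over `α` has sign the product of the
signs of the bijections between the fibres. -/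
theorem sign_eq_prod_of_fiberwise {α : Type*} [Fintype α] [DecidableEq α]
    (ρ : Equiv.Perm (α × Fin 2)) (hρ : ∀ k, (ρ (k, 0)).1 = (ρ (k, 1)).1) :
    ((Equiv.Perm.sign ρ : ℤ) : ℂ) = ∏ k, if (ρ (k, 0)).2 = 0 then (1 : ℂ) else -1 := by
  have hne : ∀ k, (ρ (k, 0)).2 ≠ (ρ (k, 1)).2 := by
    intro k h
    have := ρ.injective (Prod.ext (hρ k) h)
    simp at this
  have hτ : Function.Injective fun k => (ρ (k, 0)).1 := by
    intro k k' h
    simp only at h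
    have : ρ (k', 0) = ρ (k, 0) ∨ ρ (k', 0) = ρ (k, 1) := by
      have := hne k
      by_cases h2 : (ρ (k', 0)).2 = (ρ (k, 0)).2
      · exact Or.inl (Prod.ext h.symm h2)
      · exact Or.inr (Prod.ext (h.symm.trans (hρ k)) (by omega))
    rcases this with h | h
    · exact (congrArg Prod.fst (ρ.injective h)).symm
    · exact (congrArg Prod.fst (ρ.injective h)).symm
  let τ : Equiv.Perm α := Equiv.ofBijective _ (Finite.injective_iff_bijective.1 hτ)
  let s : α → Equiv.Perm (Fin 2) := fun k => if (ρ (k, 0)).2 = 0 then 1 else Equiv.swap 0 1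
  have hfac : ρ = Equiv.prodCongrLeft (fun _ : Fin 2 => τ) * Equiv.prodCongrRight s := by
    ext1 ⟨k, ε⟩
    have hk := hne k
    change ρ (k, ε) = ((ρ (k, 0)).1, s k ε)
    by_cases h0 : (ρ (k, 0)).2 = 0
    · have h1 : (ρ (k, 1)).2 = 1 := by omega
      simp only [s, h0, if_true, Equiv.Perm.one_apply]
      fin_cases ε
      · exact Prod.ext rfl h0
      · exact Prod.ext (hρ k).symm h1
    · have h0' : (ρ (k, 0)).2 = 1 := by omega
      have h1 : (ρ (k, 1)).2 = 0 := by omega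
      simp only [s, h0, if_false]
      fin_cases ε
      · exact Prod.ext rfl (by simpa using h0')
      · exact Prod.ext (hρ k).symm (by simpa using h1)
  have hsign : Equiv.Perm.sign ρ = ∏ k, Equiv.Perm.sign (s k) := by
    rw [hfac, Equiv.Perm.sign_mul, Equiv.Perm.sign_prodCongrLeft, Equiv.Perm.sign_prodCongrRight,
      Fin.prod_univ_two, Int.units_mul_self, one_mul]
  rw [hsign]
  push_cast
  refine Finset.prod_congr rfl fun k _ => ?_
  by_cases h0 : (ρ (k, 0)).2 = 0
  · simp [s, h0]
  · simp [s, h0]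

/-- There is no cancellation: a permutation contributes only if it permutes the pairs, and then its
sign equals the product of the signs of the entries. The sum thus counts such permutations, the
identity among them. -/
theorem pfaffian_skewBlocks_one_ne_zero (hn : Even n) :
    pfaffian (skewBlocks n fun _ => 1) ≠ 0 := by
  rw [pfaffian_eq]
  refine mul_ne_zero (pfNorm_ne_zero n) ?_
  let F : Equiv.Perm (Fin n) → ℕ := fun σ =>
    if ∀ k : Fin (n / 2), skewBlocks n (fun _ => 1) (σ (pairFst k)) (σ (pairSnd k)) ≠ 0
    then 1 else 0
  have hF : ∀ σ : Equiv.Perm (Fin n), ((Equiv.Perm.sign σ : ℤ) : ℂ) *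
      ∏ k : Fin (n / 2), skewBlocks n (fun _ => 1) (σ (pairFst k)) (σ (pairSnd k)) = F σ := by
    intro σ
    by_cases h : ∀ k : Fin (n / 2), skewBlocks n (fun _ => 1) (σ (pairFst k)) (σ (pairSnd k)) ≠ 0
    · simp only [F, if_pos h, Nat.cast_one]
      set e := pairEquiv hn
      set ρ : Equiv.Perm (Fin (n / 2) × Fin 2) := e.symm.permCongr σ with hρ
      have hval : ∀ p, σ (e p) = e (ρ p) := by intro p; simp [hρ, Equiv.permCongr_apply]
      have hsign : Equiv.Perm.sign σ = Equiv.Perm.sign ρ := (Equiv.Perm.sign_permCongr _ _).symm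
      have hval' : ∀ k, skewBlocks n (fun _ => 1) (σ (pairFst k)) (σ (pairSnd k)) =
          if (ρ (k, 0)).1 = (ρ (k, 1)).1 ∧ (ρ (k, 0)).2 ≠ (ρ (k, 1)).2 then
            (if (ρ (k, 0)).2 = 0 then (1 : ℂ) else -1) else 0 := by
        intro k
        rw [← pairEquiv_zero hn, ← pairEquiv_one hn, hval, hval, skewBlocks_pairEquiv]
      have hfib : ∀ k, (ρ (k, 0)).1 = (ρ (k, 1)).1 ∧ (ρ (k, 0)).2 ≠ (ρ (k, 1)).2 := by
        intro k
        by_contra hk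
        exact h k (by rw [hval', if_neg hk])
      rw [hsign, sign_eq_prod_of_fiberwise ρ fun k => (hfib k).1, ← Finset.prod_mul_distrib]
      refine Finset.prod_eq_one fun k _ => ?_
      rw [hval', if_pos (hfib k)]
      split_ifs <;> norm_num
    · simp only [F, if_neg h, Nat.cast_zero]
      push Not at h
      obtain ⟨k, hk⟩ := h
      rw [Finset.prod_eq_zero (Finset.mem_univ k) hk, mul_zero]
  have hsum : pfSum (skewBlocks n fun _ => 1) = ((∑ σ, F σ : ℕ) : ℂ) := by
    rw [pfSum, Nat.cast_sum]
    exact Finset.sum_congr rfl fun σ _ => hF σ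
  rw [hsum, Nat.cast_ne_zero]
  have h1 : F 1 = 1 := by
    refine if_pos fun k => ?_
    rw [Equiv.Perm.one_apply, Equiv.Perm.one_apply, ← pairEquiv_zero hn, ← pairEquiv_one hn,
      skewBlocks_pairEquiv]
    simp
  have := Finset.single_le_sum (f := F) (fun σ _ => Nat.zero_le _) (Finset.mem_univ 1)
  omega

theorem pfaffian_skewBlocks (hn : Even n) (c : ℕ → ℂ) :
    pfaffian (skewBlocks n c) =
      (∏ k : Fin (n / 2), c k) * pfaffian (skewBlocks n fun _ => 1) := by
  rw [skewBlocks_eq_congruence c, pfaffian_congruence hn, det_diagonal, prod_eq_prod_pairs hn]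
  congr 1
  refine Finset.prod_congr rfl fun k _ => ?_
  have h1 : (2 * (k : ℕ) + 1) / 2 = k := by omega
  simp [pairFst, pairSnd, Nat.add_mod]

/-- The derivative of the Pfaffian at `X`. -/
noncomputable def pfDeriv (X : Matrix (Fin n) (Fin n) ℂ) : Matrix (Fin n) (Fin n) ℂ →ₗ[ℂ] ℂ where
  toFun Z := pfNorm n * ∑ σ : Equiv.Perm (Fin n), ((Equiv.Perm.sign σ : ℤ) : ℂ) *
    ∑ k : Fin (n / 2), (∏ k' ∈ Finset.univ.erase k, X (σ (pairFst k')) (σ (pairSnd k'))) *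
      Z (σ (pairFst k)) (σ (pairSnd k))
  map_add' Z Z' := by
    simp only [Matrix.add_apply, mul_add, Finset.sum_add_distrib]
  map_smul' r Z := by
    simp only [Matrix.smul_apply, smul_eq_mul, RingHom.id_apply, Finset.mul_sum]
    refine Finset.sum_congr rfl fun σ _ => Finset.sum_congr rfl fun k _ => ?_
    ring

theorem hasDerivAt_pfaffian_comp {M : ℂ → Matrix (Fin n) (Fin n) ℂ}
    {Z : Matrix (Fin n) (Fin n) ℂ} {t : ℂ} (hM : ∀ a b, HasDerivAt (fun t => M t a b) (Z a b) t) :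
    HasDerivAt (fun t : ℂ => pfaffian (M t)) (pfDeriv (M t) Z) t := by
  change HasDerivAt (fun t : ℂ => pfNorm n * ∑ σ : Equiv.Perm (Fin n),
    ((Equiv.Perm.sign σ : ℤ) : ℂ) * ∏ k : Fin (n / 2), M t (σ (pairFst k)) (σ (pairSnd k))) _ t
  exact HasDerivAt.const_mul _ (HasDerivAt.fun_sum fun σ _ => HasDerivAt.const_mul _
    (HasDerivAt.fun_finsetProd fun k _ => hM _ _))

theorem hasDerivAt_pfaffian (X Z : Matrix (Fin n) (Fin n) ℂ) :
    HasDerivAt (fun t : ℂ => pfaffian (X + t • Z)) (pfDeriv X Z) 0 := by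
  have h := hasDerivAt_pfaffian_comp (M := fun t => X + t • Z) (Z := Z) (t := 0) (fun a b => by
    simpa using ((hasDerivAt_id (0 : ℂ)).mul_const (Z a b)).const_add (X a b))
  simpa using h

theorem pfDeriv_congruence (hn : Even n) (h X Z : Matrix (Fin n) (Fin n) ℂ) :
    pfDeriv (h * X * hᵀ) (h * Z * hᵀ) = h.det * pfDeriv X Z := by
  have h1 := (hasDerivAt_pfaffian X Z).const_mul h.det
  have h2 := hasDerivAt_pfaffian (h * X * hᵀ) (h * Z * hᵀ)
  refine h2.unique (h1.congr_of_eventuallyEq (Filter.Eventually.of_forall fun t => ?_))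
  simp only
  rw [← pfaffian_congruence hn]
  congr 1
  rw [mul_add, add_mul, mul_smul_comm, smul_mul_assoc]

theorem hasDerivAt_det_one_add (A : Matrix (Fin n) (Fin n) ℂ) :
    HasDerivAt (fun t : ℂ => (1 + t • A).det) A.trace 0 := by
  rw [show (fun t : ℂ => (1 + t • A).det) = _ from funext fun t => det_one_add_smul t A]
  have h := (((hasDerivAt_id (0 : ℂ)).const_mul A.trace).const_add 1).fun_add
    (((det (1 + (Polynomial.X : Polynomial ℂ) • A.map Polynomial.C)).divX.divX.hasDerivAt 0).fun_mul
      ((hasDerivAt_id (0 : ℂ)).fun_pow 2))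
  refine h.congr_deriv ?_
  simp only [id]
  ring

/-- Euler's relation for the infinitesimal congruence action. -/
theorem pfDeriv_mul_add_mul_transpose (hn : Even n) (X A : Matrix (Fin n) (Fin n) ℂ) :
    pfDeriv X (A * X + X * Aᵀ) = A.trace * pfaffian X := by
  have h1 := (hasDerivAt_det_one_add A).mul_const (pfaffian X)
  have h2 := hasDerivAt_pfaffian_comp (t := 0)
    -- The curve is `(1 + t • A) * X * (1 + t • A)ᵀ`, along which the Pfaffian is `det (1 + t • A) *
    -- pfaffian X`.
    (M := fun t => X + t • (A * X + X * Aᵀ) + t ^ 2 • (A * X * Aᵀ)) (Z := A * X + X * Aᵀ)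
    (fun a b => by
      have := (((hasDerivAt_id (0 : ℂ)).mul_const ((A * X + X * Aᵀ) a b)).const_add (X a b)).fun_add
        (((hasDerivAt_id (0 : ℂ)).fun_pow 2).mul_const ((A * X * Aᵀ) a b))
      refine this.congr_deriv ?_
      simp)
  have h3 := h2.unique (h1.congr_of_eventuallyEq (Filter.Eventually.of_forall fun t => ?_))
  · simpa using h3
  · simp only
    rw [← pfaffian_congruence hn]
    congr 1
    simp only [transpose_add, transpose_one, transpose_smul, add_mul, mul_add, one_mul, mul_one,
      smul_mul_assoc, mul_smul_comm, smul_add, smul_smul, ← pow_two]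
    abel

end Pfaffian

end GelfandZeitlin

namespace GelfandZeitlin

open Matrix Module

/-! ### Normal form of skew-symmetric matrices under congruence. -/

section NormalForm

variable {n : ℕ}

theorem dotProduct_mulVec_skew {y : Matrix (Fin n) (Fin n) ℂ} (hy : yᵀ = -y) (u w : Fin n → ℂ) :
    u ⬝ᵥ (y *ᵥ w) = -(w ⬝ᵥ (y *ᵥ u)) := by
  rw [dotProduct_mulVec, ← mulVec_transpose, hy, neg_mulVec, neg_dotProduct, dotProduct_comm]

/-- Every alternating form has a basis with block diagonal Gram matrix. -/
theorem exists_basis_gram_eq_skewBlocks (n : ℕ) : ∀ (V : Type) [AddCommGroup V] [Module ℂ V]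
    [FiniteDimensional ℂ V] (B : V →ₗ[ℂ] V →ₗ[ℂ] ℂ), finrank ℂ V = n → (∀ v, B v v = 0) →
    ∃ k, 2 * k ≤ n ∧ ∃ b : Basis (Fin n) ℂ V, ∀ i j,
      B (b i) (b j) = skewBlocks n (fun m => if m < k then 1 else 0) i j := by
  induction n using Nat.strong_induction_on with
  | _ n ih =>
  intro V _ _ _ B hV hB
  have hflip : ∀ u w, B w u = -B u w := by
    intro u w
    have h := hB (u + w)
    simp only [map_add, LinearMap.add_apply, hB, zero_add, add_zero] at h
    exact eq_neg_of_add_eq_zero_left h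
  by_cases h0 : B = 0
  · refine ⟨0, by omega, finBasisOfFinrankEq ℂ V hV, fun i j => ?_⟩
    simp [h0, skewBlocks]
  obtain ⟨u, w, huw⟩ : ∃ u w, B u w = 1 := by
    obtain ⟨u, hu⟩ : ∃ u, B u ≠ 0 := by
      by_contra! h
      exact h0 (LinearMap.ext h)
    obtain ⟨w, hw⟩ : ∃ w, B u w ≠ 0 := by
      by_contra! h
      exact hu (LinearMap.ext h)
    exact ⟨u, (B u w)⁻¹ • w, by rw [map_smul, smul_eq_mul, inv_mul_cancel₀ hw]⟩
  have hwu : B w u = -1 := by rw [hflip, huw]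
  -- The kernel of `T` is the orthogonal complement of the hyperbolic plane spanned by `u` and `w`;
  -- induction applies to it.
  let T : V →ₗ[ℂ] ℂ × ℂ := (B u).prod (B w)
  have hT : LinearMap.range T = ⊤ := by
    rw [LinearMap.range_eq_top]
    rintro ⟨a, b⟩
    refine ⟨a • w - b • u, ?_⟩
    simp [T, huw, hwu, hB]
  let W := LinearMap.ker T
  have hW : finrank ℂ W + 2 = n := by
    have := LinearMap.finrank_range_add_finrank_ker T
    rw [hT, finrank_top, finrank_prod, finrank_self, hV] at this
    change finrank ℂ (LinearMap.ker T) + 2 = n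
    omega
  have hWu : ∀ x ∈ W, B u x = 0 := fun x hx => congrArg Prod.fst (LinearMap.mem_ker.1 hx)
  have hWw : ∀ x ∈ W, B w x = 0 := fun x hx => congrArg Prod.snd (LinearMap.mem_ker.1 hx)
  obtain ⟨n', rfl⟩ : ∃ n', n = n' + 2 := ⟨_, hW.symm⟩
  obtain ⟨k, hk, b, hb⟩ := ih n' (by omega) W (B.compl₁₂ W.subtype W.subtype) (by omega)
    (fun x => hB x)
  let b' : Fin (n' + 2) → V := Fin.cons u (Fin.cons w fun i => (b i : V))
  have hspan : Submodule.span ℂ (Set.range fun i => (b i : V)) ≤ W := by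
    rw [Submodule.span_le]; rintro _ ⟨i, rfl⟩; exact (b i).2
  have hspan' : Submodule.span ℂ (Set.range (Fin.cons w fun i => (b i : V) : Fin (n' + 1) → V)) ≤
      LinearMap.ker (B w) := by
    rw [Submodule.span_le]
    rintro _ ⟨i, rfl⟩
    refine Fin.cases ?_ (fun i => ?_) i
    · exact hB w
    · exact hWw _ (b i).2
  have hli : LinearIndependent ℂ b' := by
    rw [linearIndependent_finCons, linearIndependent_finCons]
    refine ⟨⟨b.linearIndependent.map' W.subtype W.ker_subtype, fun h => ?_⟩, fun h => ?_⟩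
    · have := hWu _ (hspan h)
      rw [huw] at this; exact one_ne_zero this
    · have : B w u = 0 := hspan' h
      rw [hwu] at this
      norm_num at this
  refine ⟨k + 1, by omega, basisOfLinearIndependentOfCardEqFinrank hli (by simp [hV]), ?_⟩
  rw [coe_basisOfLinearIndependentOfCardEqFinrank]
  have hbW : ∀ i j, B (b i : V) (b j : V) =
    skewBlocks n' (fun m => if m < k then 1 else 0) i j := hb
  intro i j
  refine Fin.cases ?_ (fun i => Fin.cases ?_ (fun i => ?_) i) i <;>
  refine Fin.cases ?_ (fun j => Fin.cases ?_ (fun j => ?_) j) j <;>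
  simp only [b', Fin.cons_zero, Fin.cons_succ]
  · simp [hB, skewBlocks]
  · simp [huw, skewBlocks]
  · rw [hWu _ (b j).2]; simp [skewBlocks]
  · simp [hwu, skewBlocks]
  · simp [hB, skewBlocks]
  · rw [hWw _ (b j).2]; simp [skewBlocks]
  · rw [hflip, hWu _ (b i).2]; simp [skewBlocks]
  · rw [hflip, hWw _ (b i).2]; simp [skewBlocks]
  · rw [hbW]
    simp only [skewBlocks, of_apply, Fin.val_succ]
    have e : ∀ m : ℕ, (m + 1 + 1) / 2 < k + 1 ↔ m / 2 < k := by intro m; omega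
    have e1 : ∀ m : ℕ, (m + 1 + 1) % 2 = m % 2 := by intro m; omega
    simp only [e, e1, Nat.add_right_cancel_iff]

theorem exists_congruence_eq_skewBlocks {y : Matrix (Fin n) (Fin n) ℂ} (hy : yᵀ = -y) :
    ∃ k, 2 * k ≤ n ∧ ∃ h : Matrix (Fin n) (Fin n) ℂ, IsUnit h.det ∧
      h * y * hᵀ = skewBlocks n (fun m => if m < k then 1 else 0) := by
  obtain ⟨k, hk, b, hb⟩ := exists_basis_gram_eq_skewBlocks n (Fin n → ℂ)
    (Matrix.toLinearMap₂' ℂ y) (finrank_fin_fun ℂ) (fun v => by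
      rw [toLinearMap₂'_apply']
      exact self_eq_neg.1 (dotProduct_mulVec_skew hy v v))
  refine ⟨k, hk, Matrix.of fun i => b i, ?_, ?_⟩
  · rw [← isUnit_iff_isUnit_det, ← linearIndependent_rows_iff_isUnit]
    exact b.linearIndependent
  · ext i j
    rw [← hb, toLinearMap₂'_apply', dotProduct_mulVec, mul_apply']
    rfl

theorem rank_congruence {h y : Matrix (Fin n) (Fin n) ℂ} (hh : IsUnit h.det) :
    (h * y * hᵀ).rank = y.rank := by
  rw [rank_mul_eq_left_of_isUnit_det _ _ (by rwa [det_transpose]),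
    rank_mul_eq_right_of_isUnit_det _ _ hh]

/-- Up to the column permutation exchanging the members of each pair (and fixing the last index if
`n` is odd) the matrix is diagonal, with exactly `2k` nonzero entries. -/
theorem rank_skewBlocks {k : ℕ} (hk : 2 * k ≤ n) :
    (skewBlocks n (fun m => if m < k then 1 else 0)).rank = 2 * k := by
  let s : Fin n → Fin n := fun a =>
    if (a : ℕ) % 2 = 0 then (if h : (a : ℕ) + 1 < n then ⟨a + 1, h⟩ else a) else ⟨a - 1, by omega⟩
  have hsv : ∀ a, (s a : ℕ) =
      if (a : ℕ) % 2 = 0 then (if (a : ℕ) + 1 < n then (a : ℕ) + 1 else a) else a - 1 := by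
    intro a; simp only [s]; split_ifs <;> rfl
  have hs : Function.Involutive s := by
    intro a
    apply Fin.ext
    have h1 := hsv (s a)
    have h2 := hsv a
    have := a.2
    split_ifs at h1 h2 <;> omega
  let ε : Fin n → ℂ := fun a => if (a : ℕ) < 2 * k then (if (a : ℕ) % 2 = 0 then 1 else -1) else 0
  have hJ : skewBlocks n (fun m => if m < k then 1 else 0) =
      (diagonal ε).submatrix (Equiv.refl _) (hs.toPerm) := by
    ext a b
    have h2 := hsv b
    have ha := a.2
    simp only [skewBlocks, of_apply, submatrix_apply, Equiv.refl_apply, diagonal_apply, ε,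
      Function.Involutive.coe_toPerm, Fin.ext_iff]
    rw [h2]
    split_ifs <;> first | rfl | omega | simp
  rw [hJ, rank_submatrix, rank_diagonal, Fintype.card_subtype]
  have : (Finset.univ.filter fun a => ε a ≠ 0) =
      (Finset.univ : Finset (Fin (2 * k))).map (Fin.castLEEmb hk) := by
    ext a
    simp only [Finset.mem_filter, Finset.mem_univ, true_and, Finset.mem_map, ε]
    constructor
    · intro h
      refine ⟨⟨a, ?_⟩, rfl⟩
      by_contra h'
      exact h (if_neg h')
    · rintro ⟨c, rfl⟩
      rw [if_pos (show ((Fin.castLEEmb hk c : Fin n) : ℕ) < 2 * k from c.2)]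
      split_ifs <;> norm_num
  rw [this, Finset.card_map, Finset.card_univ, Fintype.card_fin]

theorem even_rank_of_skew {y : Matrix (Fin n) (Fin n) ℂ} (hy : yᵀ = -y) : Even y.rank := by
  obtain ⟨k, hk, h, hh, hJ⟩ := exists_congruence_eq_skewBlocks hy
  rw [← rank_congruence hh, hJ, rank_skewBlocks hk]
  exact even_two_mul k

theorem exists_pfDeriv_ne_zero (hn : Even n) (hn0 : 0 < n) {y : Matrix (Fin n) (Fin n) ℂ}
    (hy : yᵀ = -y) (hr : n ≤ y.rank + 2) : ∃ Z, Zᵀ = -Z ∧ pfDeriv y Z ≠ 0 := by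
  obtain ⟨k, hk, h, hh, hJ⟩ := exists_congruence_eq_skewBlocks hy
  have hrank : y.rank = 2 * k := by rw [← rank_congruence hh, hJ, rank_skewBlocks hk]
  obtain ⟨l, rfl⟩ := hn
  set c : ℕ → ℂ := fun m => if m < k then 1 else 0 with hc
  -- By the rank hypothesis `k ≥ l - 1`, so at most the last block is zero. Moving in the direction
  -- of that block makes the Pfaffian affine in `t` with nonzero slope.
  let δ : ℕ → ℂ := fun m => if m = l - 1 then 1 else 0
  have hlin : ∀ t : ℂ, skewBlocks (l + l) c + t • skewBlocks (l + l) δ =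
      skewBlocks (l + l) (fun m => c m + t * δ m) := by
    intro t; ext a b
    simp only [skewBlocks, Matrix.add_apply, Matrix.smul_apply, of_apply, smul_eq_mul]
    split_ifs
    · rfl
    · ring
    · ring
  have hd1 := hasDerivAt_pfaffian (skewBlocks (l + l) c) (skewBlocks (l + l) δ)
  have hd2 : HasDerivAt (fun t : ℂ => (c (l - 1) + t) * pfaffian (skewBlocks (l + l) fun _ => 1))
      (1 * pfaffian (skewBlocks (l + l) fun _ => 1)) 0 :=
    ((hasDerivAt_id (0 : ℂ)).const_add _).mul_const _
  have hne : pfDeriv (skewBlocks (l + l) c) (skewBlocks (l + l) δ) ≠ 0 := by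
    rw [hd1.unique (hd2.congr_of_eventuallyEq (Filter.Eventually.of_forall fun t => ?_)), one_mul]
    · exact pfaffian_skewBlocks_one_ne_zero ⟨l, rfl⟩
    · simp only
      rw [hlin, pfaffian_skewBlocks ⟨l, rfl⟩]
      congr 1
      rw [Finset.prod_eq_single ⟨l - 1, by omega⟩]
      · simp [δ]
      · intro b _ hb
        have : (b : ℕ) ≠ l - 1 := fun h => hb (Fin.ext h)
        have h2 : (b : ℕ) < k := by omega
        simp [δ, this, hc, h2]
      · simp
  refine ⟨h⁻¹ * skewBlocks (l + l) δ * h⁻¹ᵀ, ?_, fun h0 => hne ?_⟩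
  · simp [transpose_mul, transpose_skewBlocks, mul_assoc]
  · have h1 := pfDeriv_congruence ⟨l, rfl⟩ h y (h⁻¹ * skewBlocks (l + l) δ * h⁻¹ᵀ)
    have h2 : h * (h⁻¹ * skewBlocks (l + l) δ * h⁻¹ᵀ) * hᵀ = skewBlocks (l + l) δ := by
      have e1 : h⁻¹ᵀ * hᵀ = 1 := by rw [← transpose_mul, mul_nonsing_inv _ hh, transpose_one]
      rw [mul_assoc, mul_assoc, e1, mul_one, ← mul_assoc, mul_nonsing_inv _ hh, one_mul]
    rwa [hJ, h2, h0, mul_zero] at h1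

end NormalForm

/-! ### The gradient of the Pfaffian, and skew matrices killed by `y`. -/

section Gradient

variable {n : ℕ}

/-- The gradient of the Pfaffian with respect to the trace form. -/
noncomputable def pfGrad (X : Matrix (Fin n) (Fin n) ℂ) : Matrix (Fin n) (Fin n) ℂ :=
  Matrix.of fun a b => 2⁻¹ * pfDeriv X (single b a 1 - single a b 1)

theorem transpose_pfGrad (X : Matrix (Fin n) (Fin n) ℂ) : (pfGrad X)ᵀ = -pfGrad X := by
  ext a b
  simp only [pfGrad, transpose_apply, of_apply, Matrix.neg_apply]
  rw [← neg_sub, map_neg, mul_neg]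

theorem trace_pfGrad_mul (X : Matrix (Fin n) (Fin n) ℂ) {Z : Matrix (Fin n) (Fin n) ℂ}
    (hZ : Zᵀ = -Z) : (pfGrad X * Z).trace = pfDeriv X Z := by
  have h1 : (pfGrad X * Z).trace = 2⁻¹ * pfDeriv X (Z - Zᵀ) := by
    have e1 : Z = ∑ a, ∑ b, Z b a • single b a 1 := by
      conv_lhs => rw [matrix_eq_sum_single Z, Finset.sum_comm]
      simp
    have e2 : Zᵀ = ∑ a, ∑ b, Z b a • single a b 1 := by
      conv_lhs => rw [matrix_eq_sum_single Zᵀ]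
      simp
    rw [e2]; nth_rw 2 [e1]
    rw [← Finset.sum_sub_distrib]
    simp_rw [← Finset.sum_sub_distrib, ← smul_sub, map_sum, map_smul, trace, diag_apply, mul_apply,
      pfGrad, of_apply, smul_eq_mul, Finset.mul_sum]
    refine Finset.sum_congr rfl fun a _ => Finset.sum_congr rfl fun b _ => ?_
    ring
  rw [h1, hZ, sub_neg_eq_add, ← two_smul ℂ Z, map_smul, smul_eq_mul]
  ring

/-- In Euler's relation the two summands of `A * X + X * Aᵀ` have the same pairing with the
gradient, namely `tr (A * (X * pfGrad X))`. As `A` is arbitrary, the trace identity is a matrix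
identity. -/
theorem mul_pfGrad (hn : Even n) {X : Matrix (Fin n) (Fin n) ℂ} (hX : Xᵀ = -X) :
    X * pfGrad X = (2⁻¹ * pfaffian X) • 1 := by
  have key : ∀ A : Matrix (Fin n) (Fin n) ℂ,
      (A * (X * pfGrad X)).trace = (A * ((2⁻¹ * pfaffian X) • 1)).trace := by
    intro A
    have h1 := pfDeriv_mul_add_mul_transpose hn X A
    rw [← trace_pfGrad_mul X (by simp [transpose_mul, hX, add_comm]), mul_add, trace_add] at h1
    have h2 : (pfGrad X * (A * X)).trace = (A * (X * pfGrad X)).trace := by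
      rw [trace_mul_comm, mul_assoc]
    have h3 : (pfGrad X * (X * Aᵀ)).trace = (A * (X * pfGrad X)).trace := by
      rw [← trace_transpose, transpose_mul, transpose_mul, transpose_transpose, hX,
        transpose_pfGrad, mul_assoc]
      simp
    rw [h2, h3] at h1
    rw [mul_smul_comm, mul_one, trace_smul, smul_eq_mul]
    linear_combination h1 / 2
  exact ext_iff_trace_mul_left.2 key

theorem pfGrad_mul (hn : Even n) {X : Matrix (Fin n) (Fin n) ℂ} (hX : Xᵀ = -X) :
    pfGrad X * X = (2⁻¹ * pfaffian X) • 1 := by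
  have := congrArg transpose (mul_pfGrad hn hX)
  rwa [transpose_mul, hX, transpose_pfGrad, neg_mul_neg, transpose_smul, transpose_one] at this

theorem pfGrad_ne_zero (hn : Even n) (hn0 : 0 < n) {y : Matrix (Fin n) (Fin n) ℂ}
    (hy : yᵀ = -y) (hr : n ≤ y.rank + 2) : pfGrad y ≠ 0 := by
  intro h
  obtain ⟨Z, hZ, hne⟩ := exists_pfDeriv_ne_zero hn hn0 hy hr
  rw [← trace_pfGrad_mul y hZ, h, zero_mul, trace_zero] at hne
  exact hne rfl

/-- A skew-symmetric matrix annihilated by `y` is determined by its values on a complement of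
the range of `y`. -/
theorem eq_zero_of_mul_eq_zero_of_skew {y A : Matrix (Fin n) (Fin n) ℂ} (hy : yᵀ = -y)
    (hA : Aᵀ = -A) (hyA : y * A = 0) {e f : Fin n → ℂ}
    (hef : LinearMap.range (mulVecLin y) ⊔ Submodule.span ℂ {e} ⊔ Submodule.span ℂ {f} = ⊤)
    (h : e ⬝ᵥ (A *ᵥ f) = 0) : A = 0 := by
  -- The range of `y` lies in the radical of the alternating form `A`, which therefore lives on a
  -- quotient spanned by `e` and `f` and is determined by one value.
  have h1 : ∀ x w, (y *ᵥ x) ⬝ᵥ (A *ᵥ w) = 0 := by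
    intro x w
    rw [dotProduct_comm, dotProduct_mulVec_skew hy, mulVec_mulVec, hyA, zero_mulVec,
      dotProduct_zero, neg_zero]
  have h2 : ∀ x w, w ⬝ᵥ (A *ᵥ (y *ᵥ x)) = 0 := by
    intro x w
    rw [dotProduct_mulVec_skew hA, h1, neg_zero]
  have h3 : ∀ w, w ⬝ᵥ (A *ᵥ w) = 0 := fun w => self_eq_neg.1 (dotProduct_mulVec_skew hA w w)
  have h4 : f ⬝ᵥ (A *ᵥ e) = 0 := by rw [dotProduct_mulVec_skew hA, h, neg_zero]
  have hdec : ∀ w : Fin n → ℂ, ∃ x, ∃ a b : ℂ, w = y *ᵥ x + a • e + b • f := by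
    intro w
    obtain ⟨p, hp, q, hq, rfl⟩ := Submodule.mem_sup.1 (hef ▸ Submodule.mem_top : w ∈ _)
    obtain ⟨p', hp', q', hq', rfl⟩ := Submodule.mem_sup.1 hp
    obtain ⟨x, rfl⟩ := hp'
    obtain ⟨a, rfl⟩ := Submodule.mem_span_singleton.1 hq'
    obtain ⟨b, rfl⟩ := Submodule.mem_span_singleton.1 hq
    exact ⟨x, a, b, rfl⟩
  have hall : ∀ w w', w ⬝ᵥ (A *ᵥ w') = 0 := by
    intro w w'
    obtain ⟨x, a, b, rfl⟩ := hdec w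
    obtain ⟨x', a', b', rfl⟩ := hdec w'
    simp [mulVec_add, mulVec_smul, h1, h2, h3, h4, h, -mulVec_mulVec]
  ext i j
  simpa using hall (Pi.single i 1) (Pi.single j 1)

theorem eq_zero_of_mul_eq_zero_of_rank {y A : Matrix (Fin n) (Fin n) ℂ} (hy : yᵀ = -y)
    (hA : Aᵀ = -A) (hyA : y * A = 0) (hr : n ≤ y.rank + 1) : A = 0 := by
  obtain ⟨e, he⟩ := exists_finrank_sup_span_singleton (LinearMap.range (mulVecLin y))
  change min n (y.rank + 1) ≤ _ at he
  rw [min_eq_left hr] at he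
  have htop : LinearMap.range (mulVecLin y) ⊔ Submodule.span ℂ {e} = ⊤ :=
    Submodule.eq_top_of_finrank_eq (le_antisymm (Submodule.finrank_le _) (by rwa [finrank_fin_fun]))
  refine eq_zero_of_mul_eq_zero_of_skew hy hA hyA (e := e) (f := e) (by rw [htop, top_sup_eq]) ?_
  exact self_eq_neg.1 (dotProduct_mulVec_skew hA e e)

theorem exists_smul_eq_of_mul_eq_zero_of_rank {y A B : Matrix (Fin n) (Fin n) ℂ} (hy : yᵀ = -y)
    (hA : Aᵀ = -A) (hyA : y * A = 0) (hB : Bᵀ = -B) (hyB : y * B = 0) (hA0 : A ≠ 0)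
    (hr : n ≤ y.rank + 2) : ∃ r : ℂ, B = r • A := by
  obtain ⟨e, he⟩ := exists_finrank_sup_span_singleton (LinearMap.range (mulVecLin y))
  obtain ⟨f, hf⟩ := exists_finrank_sup_span_singleton
    (LinearMap.range (mulVecLin y) ⊔ Submodule.span ℂ {e})
  have htop : LinearMap.range (mulVecLin y) ⊔ Submodule.span ℂ {e} ⊔ Submodule.span ℂ {f} = ⊤ := by
    refine Submodule.eq_top_of_finrank_eq (le_antisymm (Submodule.finrank_le _) ?_)
    rw [finrank_fin_fun]
    change min n (y.rank + 1) ≤ _ at he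
    omega
  have hne : e ⬝ᵥ (A *ᵥ f) ≠ 0 := fun h => hA0 (eq_zero_of_mul_eq_zero_of_skew hy hA hyA htop h)
  refine ⟨(e ⬝ᵥ (B *ᵥ f)) / (e ⬝ᵥ (A *ᵥ f)), sub_eq_zero.1 ?_⟩
  refine eq_zero_of_mul_eq_zero_of_skew hy ?_ ?_ htop ?_
  · rw [transpose_sub, transpose_smul, hA, hB, smul_neg, neg_sub_neg, neg_sub]
  · rw [mul_sub, mul_smul_comm, hyA, hyB, smul_zero, sub_zero]
  · rw [sub_mulVec, dotProduct_sub, smul_mulVec, dotProduct_smul, smul_eq_mul,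
      div_mul_cancel₀ _ hne, sub_self]

end Gradient

end GelfandZeitlin

namespace GelfandZeitlin

open Matrix Polynomial Module

/-! ### Kostant's criterion at a single level. -/

section Level

variable {n : ℕ}

theorem finrank_commutant_so_eq_iff {y : Matrix (Fin n) (Fin n) ℂ} (hy : yᵀ = -y) :
    finrank ℂ (commutant .so y) = n / 2 ↔
      (minpoly ℂ y).natDegree = n ∨ ((minpoly ℂ y).natDegree + 1 = n ∧ Even n) := by
  have h1 := le_finrank_commutant_so hy
  have h2 := natDegree_minpoly_le y
  by_cases hd : n ≤ (minpoly ℂ y).natDegree + 1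
  · have h3 := finrank_commutant_so_le hd hy
    rw [Nat.even_iff]
    omega
  · omega

theorem half_le_finrank_commutant_so {y : Matrix (Fin n) (Fin n) ℂ} (hy : yᵀ = -y) :
    n / 2 ≤ finrank ℂ (commutant .so y) := by
  have h1 := le_finrank_commutant_so hy
  have h2 := natDegree_minpoly_le y
  omega

theorem finrank_commutant_gl_eq_iff {y : Matrix (Fin n) (Fin n) ℂ} :
    finrank ℂ (commutant .gl y) = n ↔ (minpoly ℂ y).natDegree = n := by
  refine ⟨fun h => ?_, finrank_commutant_gl_of_eq⟩
  by_contra hne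
  have := lt_finrank_commutant_gl (lt_of_le_of_ne (natDegree_minpoly_le y) hne)
  omega

theorem le_finrank_commutant_gl (y : Matrix (Fin n) (Fin n) ℂ) :
    n ≤ finrank ℂ (commutant .gl y) := by
  rcases (natDegree_minpoly_le y).eq_or_lt with h | h
  · exact (finrank_commutant_gl_of_eq h).ge
  · exact (lt_finrank_commutant_gl h).le

theorem linearIndependent_pow (y : Matrix (Fin n) (Fin n) ℂ) :
    LinearIndependent ℂ fun i : Fin (minpoly ℂ y).natDegree => y ^ (i : ℕ) := by
  obtain ⟨v, hv⟩ := exists_cyclic_vector y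
  exact LinearIndependent.of_comp ((mulVecBilin ℂ ℂ).flip v) (linearIndependent_pow_mulVec hv)

theorem natDegree_minpoly_le_rank_add_one (y : Matrix (Fin n) (Fin n) ℂ) :
    (minpoly ℂ y).natDegree ≤ y.rank + 1 := by
  obtain ⟨v, hv⟩ := exists_cyclic_vector y
  have hli : LinearIndependent ℂ
      fun i : Fin ((minpoly ℂ y).natDegree - 1) => y ^ ((i : ℕ) + 1) *ᵥ v :=
    (linearIndependent_pow_mulVec hv).comp
      (fun i : Fin ((minpoly ℂ y).natDegree - 1) =>
        (⟨i + 1, by omega⟩ : Fin (minpoly ℂ y).natDegree))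
      (by intro i j h; simp only [Fin.mk.injEq] at h; omega)
  have hle : Submodule.span ℂ (Set.range
      fun i : Fin ((minpoly ℂ y).natDegree - 1) => y ^ ((i : ℕ) + 1) *ᵥ v) ≤
      LinearMap.range (mulVecLin y) := by
    rw [Submodule.span_le]
    rintro _ ⟨i, rfl⟩
    exact ⟨y ^ (i : ℕ) *ᵥ v, by rw [mulVecLin_apply, mulVec_mulVec, ← pow_succ']⟩
  have := Submodule.finrank_mono hle
  rw [finrank_span_eq_card hli, Fintype.card_fin] at this
  change _ ≤ y.rank at this
  omega

/-- Since `-y = yᵀ` is killed by the minimal polynomial `m`, the polynomial `(-1)^d m(-X)` also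
kills `y`. Its top coefficient is that of `m`, so by minimality the two agree. -/
theorem coeff_minpoly_eq_zero {y : Matrix (Fin n) (Fin n) ℂ} (hy : yᵀ = -y) {k : ℕ}
    (hk : k % 2 ≠ (minpoly ℂ y).natDegree % 2) : (minpoly ℂ y).coeff k = 0 := by
  have hint : IsIntegral ℂ y := Algebra.IsIntegral.isIntegral y
  set m := minpoly ℂ y with hm
  set d := m.natDegree with hd
  let q : ℂ[X] := C ((-1) ^ d) * m.comp (C (-1) * X)
  have hc : ∀ k, q.coeff k = (-1) ^ d * ((-1) ^ k * m.coeff k) := by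
    intro k
    rw [coeff_C_mul, comp_C_mul_X_coeff, mul_comm (m.coeff k)]
  have hqy : aeval y q = 0 := by
    have hX : aeval y (C (-1 : ℂ) * X) = -y := by simp
    rw [map_mul, aeval_comp, hX, hm, aeval_neg_minpoly hy, mul_zero]
  have hmq : m - q = 0 := by
    by_contra hne
    have h1 := natDegree_le_natDegree
      (minpoly.degree_le_of_ne_zero ℂ y hne (by rw [map_sub, hqy, hm, minpoly.aeval, sub_zero]))
    rw [← hm, ← hd] at h1
    have hle : (m - q).natDegree ≤ d := by
      rw [natDegree_le_iff_coeff_eq_zero]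
      intro N hN
      rw [coeff_sub, hc, coeff_eq_zero_of_natDegree_lt hN]
      simp
    have hzero : (m - q).coeff d = 0 := by
      rw [coeff_sub, hc, ← mul_assoc, ← mul_pow]
      simp
    have heq := le_antisymm hle h1
    rw [← heq, coeff_natDegree, leadingCoeff_eq_zero] at hzero
    exact hne hzero
  have := congrArg (fun p => coeff p k) hmq
  simp only [coeff_sub, hc, coeff_zero] at this
  have hs : (-1 : ℂ) ^ d * (-1) ^ k = -1 := by
    rw [← pow_add]; exact Odd.neg_one_pow (by rw [Nat.odd_iff]; omega)
  rw [← mul_assoc, hs] at this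
  have h2 : (2 : ℂ) * m.coeff k = 0 := by linear_combination this
  simpa using h2

theorem aeval_eq_sum_odd {p : ℂ[X]} (hp : ∀ k, p.coeff (2 * k) = 0) {r : ℕ}
    (hr : p.natDegree < 2 * r) (y : Matrix (Fin n) (Fin n) ℂ) :
    aeval y p = ∑ j : Fin r, p.coeff (2 * j + 1) • y ^ (2 * (j : ℕ) + 1) := by
  rw [aeval_eq_sum_range' hr, Fin.sum_univ_eq_sum_range
    (fun j => p.coeff (2 * j + 1) • y ^ (2 * j + 1))]
  clear hr
  induction r with
  | zero => simp
  | succ r ih =>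
    rw [show 2 * (r + 1) = 2 * r + 1 + 1 by ring, Finset.sum_range_succ, Finset.sum_range_succ, ih,
      Finset.sum_range_succ, hp, zero_smul, add_zero]

theorem eq_zero_of_linearIndependent_odd_pow {y : Matrix (Fin n) (Fin n) ℂ} {r : ℕ}
    (hli : LinearIndependent ℂ fun j : Fin r => y ^ (2 * (j : ℕ) + 1))
    {p : ℂ[X]} (hp : ∀ k, p.coeff (2 * k) = 0) (hr : p.natDegree < 2 * r)
    (h0 : aeval y p = 0) : p = 0 := by
  rw [aeval_eq_sum_odd hp hr] at h0
  have h := Fintype.linearIndependent_iff.1 hli _ h0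
  ext k
  rw [coeff_zero]
  rcases Nat.even_or_odd' k with ⟨j, rfl | rfl⟩
  · exact hp j
  · by_cases hj : j < r
    · exact h ⟨j, hj⟩
    · exact coeff_eq_zero_of_natDegree_lt (by omega)

theorem transpose_aeval_of_odd {y : Matrix (Fin n) (Fin n) ℂ} (hy : yᵀ = -y) {p : ℂ[X]}
    (hp : ∀ k, p.coeff (2 * k) = 0) : (aeval y p)ᵀ = -aeval y p := by
  rw [aeval_eq_sum_odd hp (r := p.natDegree + 1) (by omega), transpose_sum,
    ← Finset.sum_neg_distrib]
  refine Finset.sum_congr rfl fun j _ => ?_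
  rw [transpose_smul, transpose_pow, hy, Odd.neg_pow ⟨j, rfl⟩, smul_neg]

/-- If the odd powers of `y` below `2 r` are independent, the minimal polynomial has degree
at least `2 r`. -/
theorem two_mul_le_natDegree_minpoly {y : Matrix (Fin n) (Fin n) ℂ} (hy : yᵀ = -y) {r : ℕ}
    (hli : LinearIndependent ℂ fun j : Fin r => y ^ (2 * (j : ℕ) + 1)) :
    2 * r ≤ (minpoly ℂ y).natDegree := by
  have hint : IsIntegral ℂ y := Algebra.IsIntegral.isIntegral y
  have hm0 := minpoly.ne_zero hint
  by_contra! hlt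
  -- According to the parity of the degree, `X * minpoly` or `minpoly` itself is an odd polynomial
  -- of degree below `2r` killing `y`.
  rcases Nat.even_or_odd' (minpoly ℂ y).natDegree with ⟨j, hj | hj⟩
  · have h := eq_zero_of_linearIndependent_odd_pow hli (p := X * minpoly ℂ y) ?_ ?_ ?_
    · exact mul_ne_zero X_ne_zero hm0 h
    · intro k
      rcases k with _ | k
      · simp
      · rw [show 2 * (k + 1) = (2 * k + 1) + 1 by ring, coeff_X_mul]
        exact coeff_minpoly_eq_zero hy (by omega)
    · rw [natDegree_X_mul hm0]; omega
    · rw [map_mul, minpoly.aeval, mul_zero]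
  · refine hm0 (eq_zero_of_linearIndependent_odd_pow hli ?_ hlt (minpoly.aeval _ _))
    intro k
    exact coeff_minpoly_eq_zero hy (by omega)

theorem aeval_divX_minpoly_mul (y : Matrix (Fin n) (Fin n) ℂ) :
    aeval y (minpoly ℂ y).divX * y = -((minpoly ℂ y).coeff 0 • 1) := by
  have h := congrArg (aeval y) (divX_mul_X_add (minpoly ℂ y))
  rw [map_add, map_mul, aeval_X, aeval_C, minpoly.aeval, Algebra.algebraMap_eq_smul_one] at h
  exact eq_neg_of_add_eq_zero_left h

theorem mul_aeval_divX_minpoly (y : Matrix (Fin n) (Fin n) ℂ) :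
    y * aeval y (minpoly ℂ y).divX = -((minpoly ℂ y).coeff 0 • 1) := by
  rw [← aeval_divX_minpoly_mul]
  nth_rw 1 [← aeval_X (R := ℂ) y]
  rw [← map_mul, mul_comm, map_mul, aeval_X]

theorem aeval_divX_minpoly_ne_zero [NeZero n] (y : Matrix (Fin n) (Fin n) ℂ) :
    aeval y (minpoly ℂ y).divX ≠ 0 := by
  have hint : IsIntegral ℂ y := Algebra.IsIntegral.isIntegral y
  have hd := minpoly.natDegree_pos hint
  intro h
  have hne : (minpoly ℂ y).divX ≠ 0 := by
    intro h0
    have := natDegree_divX_eq_natDegree_tsub_one (p := minpoly ℂ y)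
    have h1 : (minpoly ℂ y).divX.coeff ((minpoly ℂ y).natDegree - 1) = 1 := by
      rw [coeff_divX, Nat.sub_add_cancel hd]
      exact minpoly.monic hint
    rw [h0, coeff_zero] at h1
    exact zero_ne_one h1
  have h1 := natDegree_le_natDegree (minpoly.degree_le_of_ne_zero ℂ y hne h)
  rw [natDegree_divX_eq_natDegree_tsub_one] at h1
  omega

theorem coeff_divX_minpoly {y : Matrix (Fin n) (Fin n) ℂ} (hy : yᵀ = -y)
    (hd : Even (minpoly ℂ y).natDegree) (k : ℕ) : (minpoly ℂ y).divX.coeff (2 * k) = 0 := by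
  rw [coeff_divX]
  refine coeff_minpoly_eq_zero hy ?_
  rw [Nat.even_iff] at hd
  omega

/-- If `d = n - 1` with `n` odd, then `y` is singular and, its rank being even and at least `d - 1`,
of rank `n - 1`. The odd polynomial `m / X` gives a skew matrix killed by `y`, hence zero, against
the minimality of `m`. -/
theorem natDegree_minpoly_add_one_ne_of_odd {y : Matrix (Fin n) (Fin n) ℂ} (hy : yᵀ = -y)
    (hn : Odd n) : (minpoly ℂ y).natDegree + 1 ≠ n := by
  intro hd
  have : NeZero n := ⟨hn.pos.ne'⟩
  have hde : Even (minpoly ℂ y).natDegree := by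
    rw [Nat.even_iff]; rw [Nat.odd_iff] at hn; omega
  have hrank := even_rank_of_skew hy
  have hle := natDegree_minpoly_le_rank_add_one y
  have hle2 : y.rank ≤ n := by simpa using y.rank_le_card_width
  rw [Nat.even_iff] at hrank
  rw [Nat.odd_iff] at hn
  have hm0 : (minpoly ℂ y).coeff 0 = 0 := by
    by_contra hne
    have hu : IsUnit y := by
      refine IsUnit.of_mul_eq_one (-((minpoly ℂ y).coeff 0)⁻¹ • aeval y (minpoly ℂ y).divX) ?_
      rw [mul_smul_comm, mul_aeval_divX_minpoly, smul_neg, neg_smul, neg_neg, smul_smul,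
        inv_mul_cancel₀ hne, one_smul]
    have := rank_of_isUnit y hu
    rw [Fintype.card_fin] at this
    omega
  refine aeval_divX_minpoly_ne_zero y
    (eq_zero_of_mul_eq_zero_of_rank hy (transpose_aeval_of_odd hy (coeff_divX_minpoly hy hde)) ?_
      (by omega))
  rw [mul_aeval_divX_minpoly, hm0, zero_smul, neg_zero]

theorem linearIndependent_odd_pow {y : Matrix (Fin n) (Fin n) ℂ} {r : ℕ}
    (hr : 2 * r ≤ (minpoly ℂ y).natDegree) :
    LinearIndependent ℂ fun j : Fin r => y ^ (2 * (j : ℕ) + 1) :=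
  (linearIndependent_pow y).comp
    (fun j : Fin r => (⟨2 * j + 1, by omega⟩ : Fin (minpoly ℂ y).natDegree))
    (by intro i j h; simp only [Fin.mk.injEq] at h; omega)

theorem linearIndependent_odd_pow_iff_of_odd {y : Matrix (Fin n) (Fin n) ℂ} (hy : yᵀ = -y) {l : ℕ}
    (hn : n = 2 * l + 1) :
    LinearIndependent ℂ (fun j : Fin l => y ^ (2 * (j : ℕ) + 1)) ↔
      (minpoly ℂ y).natDegree = n := by
  constructor
  · intro h
    have h1 := two_mul_le_natDegree_minpoly hy h
    have h2 := natDegree_minpoly_add_one_ne_of_odd hy ⟨l, hn⟩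
    have h3 := natDegree_minpoly_le y
    omega
  · intro h
    exact linearIndependent_odd_pow (by omega)

theorem linearIndependent_odd_pow_pfGrad_iff {y : Matrix (Fin n) (Fin n) ℂ} (hy : yᵀ = -y) {l : ℕ}
    (hn : n = 2 * (l + 1)) :
    (LinearIndependent ℂ (fun j : Fin l => y ^ (2 * (j : ℕ) + 1)) ∧
      pfGrad y ∉ Submodule.span ℂ (Set.range fun j : Fin l => y ^ (2 * (j : ℕ) + 1))) ↔
      n ≤ (minpoly ℂ y).natDegree + 1 := by
  have hev : Even n := ⟨l + 1, by omega⟩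
  have : NeZero n := ⟨by omega⟩
  have hrank := even_rank_of_skew hy
  rw [Nat.even_iff] at hrank
  have hle := natDegree_minpoly_le_rank_add_one y
  constructor
  · rintro ⟨hli, hP⟩
    have h1 := two_mul_le_natDegree_minpoly hy hli
    by_contra! hlt
    have hd : (minpoly ℂ y).natDegree = 2 * l := by omega
    have hq := coeff_divX_minpoly hy ⟨l, by omega⟩
    have hP0 : pfGrad y ≠ 0 := fun h => hP (h ▸ zero_mem _)
    -- Multiplied by `y`, both matrices become scalar. If the Pfaffian is nonzero this compares them
    -- directly; otherwise both are killed by `y`, whose rank, even and at least `n - 3`, is at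
    -- least `n - 2`, so they are proportional.
    have hprop : ∃ r : ℂ, aeval y (minpoly ℂ y).divX = r • pfGrad y := by
      have hcm : (2⁻¹ * pfaffian y) • aeval y (minpoly ℂ y).divX =
          -((minpoly ℂ y).coeff 0 • pfGrad y) := by
        have h : aeval y (minpoly ℂ y).divX * (y * pfGrad y) =
            (aeval y (minpoly ℂ y).divX * y) * pfGrad y := (mul_assoc _ _ _).symm
        rwa [mul_pfGrad hev hy, aeval_divX_minpoly_mul, mul_smul_comm, mul_one, neg_mul,
          smul_mul_assoc, one_mul] at h
      by_cases hc : 2⁻¹ * pfaffian y = 0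
      · rw [hc, zero_smul, eq_comm, neg_eq_zero, smul_eq_zero, or_iff_left hP0] at hcm
        refine exists_smul_eq_of_mul_eq_zero_of_rank hy (transpose_pfGrad y) ?_
          (transpose_aeval_of_odd hy hq) ?_ hP0 (by omega)
        · rw [mul_pfGrad hev hy, hc, zero_smul]
        · rw [mul_aeval_divX_minpoly, hcm, zero_smul, neg_zero]
      · refine ⟨-((2⁻¹ * pfaffian y)⁻¹ * (minpoly ℂ y).coeff 0), ?_⟩
        rw [neg_smul, mul_smul, ← smul_neg, ← hcm, smul_smul, inv_mul_cancel₀ hc, one_smul]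
    obtain ⟨r, hr⟩ := hprop
    have hq0 := aeval_divX_minpoly_ne_zero y
    have hr0 : r ≠ 0 := by
      rintro rfl
      exact hq0 (by rw [hr, zero_smul])
    apply hP
    have h2 : pfGrad y = r⁻¹ • aeval y (minpoly ℂ y).divX := by
      rw [hr, smul_smul, inv_mul_cancel₀ hr0, one_smul]
    have hpos := minpoly.natDegree_pos (A := ℂ) (Algebra.IsIntegral.isIntegral y)
    rw [h2, aeval_eq_sum_odd hq (r := l) (by rw [natDegree_divX_eq_natDegree_tsub_one]; omega)]
    exact Submodule.smul_mem _ _ (Submodule.sum_mem _ fun j _ =>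
      Submodule.smul_mem _ _ (Submodule.subset_span ⟨j, rfl⟩))
  · intro hd
    refine ⟨linearIndependent_odd_pow (by omega), fun hP => ?_⟩
    have hP0 : pfGrad y ≠ 0 := pfGrad_ne_zero hev (by omega) hy (by omega)
    obtain ⟨a, ha⟩ := (Submodule.mem_span_range_iff_exists_fun ℂ).1 hP
    have hevli : LinearIndependent ℂ fun j : Fin (l + 1) => y ^ (2 * (j : ℕ)) :=
      (linearIndependent_pow y).comp
        (fun j : Fin (l + 1) => (⟨2 * j, by omega⟩ : Fin (minpoly ℂ y).natDegree))
        (by intro i j h; simp only [Fin.mk.injEq] at h; omega)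
    -- Multiplying the relation `pfGrad y = ∑ a j • y ^ (2j+1)` by `y` gives a relation among the
    -- even powers `y ^ 0, …, y ^ (2l)`, which are independent.
    have h0 := Fintype.linearIndependent_iff.1 hevli
      (Fin.cons (-(2⁻¹ * pfaffian y)) a) (by
        rw [Fin.sum_univ_succ]
        simp only [Fin.cons_zero, Fin.cons_succ, Fin.val_zero, mul_zero, pow_zero, Fin.val_succ]
        rw [neg_smul, ← mul_pfGrad hev hy, ← ha, Finset.mul_sum, neg_add_eq_zero]
        refine Finset.sum_congr rfl fun j _ => ?_
        rw [mul_smul_comm, ← pow_succ']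
        rfl)
    apply hP0
    rw [← ha]
    refine Finset.sum_eq_zero fun j _ => ?_
    have := h0 j.succ
    rw [Fin.cons_succ] at this
    rw [this, zero_smul]

/-- The gradient, with respect to the trace form, of the `j`-th standard invariant. -/
noncomputable def invariantGrad (s : Series) (y : Matrix (Fin n) (Fin n) ℂ) (j : ℕ) :
    Matrix (Fin n) (Fin n) ℂ :=
  match s with
  | .gl => (j : ℂ) • y ^ (j - 1)
  | .so => if n = 2 * j then pfGrad y else ((2 * j : ℕ) : ℂ) • y ^ (2 * j - 1)

theorem invariantGrad_mem_commutant {s : Series} {y : Matrix (Fin n) (Fin n) ℂ} (hy : y ∈ g s n)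
    {j : ℕ} (hj : 1 ≤ j) : invariantGrad s y j ∈ commutant s y := by
  cases s with
  | gl =>
    refine ⟨mem_g_gl _, ?_⟩
    simp only [invariantGrad, mul_smul_comm, smul_mul_assoc, ← pow_succ, ← pow_succ']
  | so =>
    have hy' := mem_g_so.1 hy
    simp only [invariantGrad]
    split_ifs with h
    · refine ⟨mem_g_so.2 (transpose_pfGrad y), ?_⟩
      have hev : Even n := ⟨j, by omega⟩
      rw [mul_pfGrad hev hy', pfGrad_mul hev hy']
    · refine Submodule.smul_mem _ _ ⟨mem_g_so.2 ?_, by rw [← pow_succ, ← pow_succ']⟩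
      rw [transpose_pow, hy', Odd.neg_pow ⟨j - 1, by omega⟩]

/-- Kostant's criterion for the two series. -/
theorem linearIndependent_invariantGrad_iff {s : Series} (hn : 0 < n)
    {y : Matrix (Fin n) (Fin n) ℂ} (hy : y ∈ g s n) :
    LinearIndependent ℂ (fun j : Fin (numInvariants s n) => invariantGrad s y ((j : ℕ) + 1)) ↔
      finrank ℂ (commutant s y) = numInvariants s n := by
  cases s with
  | gl =>
    change LinearIndependent ℂ (fun j : Fin n => (((j : ℕ) + 1 : ℕ) : ℂ) • y ^ (j : ℕ)) ↔
      finrank ℂ (commutant .gl y) = n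
    rw [finrank_commutant_gl_eq_iff]
    constructor
    · intro h
      by_contra hne
      have hlt := lt_of_le_of_ne (natDegree_minpoly_le y) hne
      have h0 := Fintype.linearIndependent_iff.1 h
        -- A minimal polynomial of degree below `n` is itself a relation, once the factors `j + 1`
        -- from differentiating the traces are divided out.
        (fun j => (((j : ℕ) + 1 : ℕ) : ℂ)⁻¹ * (minpoly ℂ y).coeff j) (by
          have := minpoly.aeval ℂ y
          rw [aeval_eq_sum_range' hlt] at this
          rw [← this, ← Fin.sum_univ_eq_sum_range (fun k => (minpoly ℂ y).coeff k • y ^ k)]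
          refine Finset.sum_congr rfl fun j _ => ?_
          rw [smul_smul, mul_right_comm, inv_mul_cancel₀ (Nat.cast_ne_zero.2 (Nat.succ_ne_zero _)),
            one_mul])
      have h1 := h0 ⟨_, hlt⟩
      rw [coeff_natDegree, (minpoly.monic (Algebra.IsIntegral.isIntegral y)).leadingCoeff,
        mul_one, inv_eq_zero] at h1
      exact Nat.cast_ne_zero.2 (Nat.succ_ne_zero _) h1
    · intro h
      have hli : LinearIndependent ℂ fun i : Fin n => y ^ (i : ℕ) := by
        have := linearIndependent_pow y
        rwa [h] at this
      exact hli.units_smul (fun j : Fin n =>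
        Units.mk0 (((j : ℕ) + 1 : ℕ) : ℂ) (Nat.cast_ne_zero.2 (Nat.succ_ne_zero _)))
  | so =>
    have hy' := mem_g_so.1 hy
    change LinearIndependent ℂ (fun j : Fin (n / 2) => invariantGrad .so y ((j : ℕ) + 1)) ↔
      finrank ℂ (commutant .so y) = n / 2
    rw [finrank_commutant_so_eq_iff hy']
    have hdle := natDegree_minpoly_le y
    let c : ℕ → ℂˣ := fun j =>
      Units.mk0 ((2 * (j + 1) : ℕ) : ℂ) (Nat.cast_ne_zero.2 (by omega))
    have hpow : ∀ j, n ≠ 2 * (j + 1) → invariantGrad .so y (j + 1) = c j • y ^ (2 * j + 1) := by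
      intro j hj
      simp only [invariantGrad, if_neg hj]
      rfl
    rcases Nat.even_or_odd' n with ⟨l, hl | hl⟩
    · obtain ⟨l, rfl⟩ : ∃ l', l = l' + 1 := ⟨l - 1, by omega⟩
      have hn2 : n / 2 = l + 1 := by omega
      rw [hn2]
      have hfam : (fun j : Fin (l + 1) => invariantGrad .so y ((j : ℕ) + 1)) =
          (Fin.snoc (fun j : Fin l => c j) 1 : Fin (l + 1) → ℂˣ) •
            (Fin.snoc (fun j : Fin l => y ^ (2 * (j : ℕ) + 1)) (pfGrad y) :
              Fin (l + 1) → Matrix (Fin n) (Fin n) ℂ) := by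
        ext1 j
        rw [Pi.smul_apply']
        refine Fin.lastCases ?_ (fun j => ?_) j
        · rw [Fin.snoc_last, Fin.snoc_last]
          simp [invariantGrad, hl]
        · rw [Fin.snoc_castSucc, Fin.snoc_castSucc]
          exact hpow j (by omega)
      rw [hfam, LinearIndependent.units_smul_iff, linearIndependent_finSnoc,
        linearIndependent_odd_pow_pfGrad_iff hy' hl, Nat.even_iff]
      omega
    · have hn2 : n / 2 = l := by omega
      rw [hn2]
      have hodd : ¬ Even n := by rw [Nat.even_iff]; omega
      rw [show (minpoly ℂ y).natDegree = n ∨ (minpoly ℂ y).natDegree + 1 = n ∧ Even n ↔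
        (minpoly ℂ y).natDegree = n by tauto, ← linearIndependent_odd_pow_iff_of_odd hy' hl]
      rw [show (fun j : Fin l => invariantGrad .so y ((j : ℕ) + 1)) =
        (fun j : Fin l => c j) • (fun j : Fin l => y ^ (2 * (j : ℕ) + 1)) from
          funext fun j => hpow j (by omega), LinearIndependent.units_smul_iff]

end Level

end GelfandZeitlin

namespace GelfandZeitlin

open Matrix Polynomial Module

/-! ### The rank of the Lie algebra equals the number of invariants. -/

section Rank

variable {n : ℕ}

theorem mem_centralizer {s : Series} {X a : g s n} :
    a ∈ centralizer X ↔ (X : Matrix (Fin n) (Fin n) ℂ) * a = a * X := by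
  rw [centralizer, LinearMap.mem_ker, LieAlgebra.ad_apply, ← Subtype.coe_inj,
    LieSubalgebra.coe_bracket, LieRing.of_associative_ring_bracket]
  exact sub_eq_zero

theorem map_centralizer {s : Series} (X : g s n) :
    (centralizer X).map (g s n).toSubmodule.subtype =
      commutant s (X : Matrix (Fin n) (Fin n) ℂ) := by
  ext a
  constructor
  · rintro ⟨b, hb, rfl⟩
    exact ⟨b.2, mem_centralizer.1 hb⟩
  · rintro ⟨ha, h⟩
    exact ⟨⟨a, ha⟩, mem_centralizer.2 h, rfl⟩

theorem finrank_centralizer {s : Series} (X : g s n) :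
    finrank ℂ (centralizer X) = finrank ℂ (commutant s (X : Matrix (Fin n) (Fin n) ℂ)) := by
  rw [← map_centralizer]
  exact (Submodule.equivMapOfInjective _ Subtype.val_injective _).finrank_eq

theorem numInvariants_le_finrank_centralizer {s : Series} (X : g s n) :
    numInvariants s n ≤ finrank ℂ (centralizer X) := by
  rw [finrank_centralizer]
  cases s with
  | gl => exact le_finrank_commutant_gl _
  | so => exact half_le_finrank_commutant_so (mem_g_so.1 X.2)

/-- A Hermitian skew-symmetric matrix of Jacobi shape; it is regular in both series. -/
noncomputable def jacobi (n : ℕ) : Matrix (Fin n) (Fin n) ℂ := Matrix.of fun a b =>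
  if (b : ℕ) = a + 1 then Complex.I else if (a : ℕ) = b + 1 then -Complex.I else 0

theorem transpose_jacobi (n : ℕ) : (jacobi n)ᵀ = -jacobi n := by
  ext a b
  simp only [jacobi, transpose_apply, of_apply, Matrix.neg_apply]
  split_ifs <;> first | omega | simp

theorem conjTranspose_jacobi (n : ℕ) : (jacobi n)ᴴ = jacobi n := by
  ext a b
  simp only [jacobi, conjTranspose_apply, of_apply]
  split_ifs <;> first | omega | simp

theorem jacobi_mem (s : Series) (n : ℕ) : jacobi n ∈ g s n := by
  cases s with
  | gl => exact mem_g_gl _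
  | so => exact mem_g_so.2 (transpose_jacobi n)

/-- The first column of the `k`-th power reaches exactly down to row `k`; this triangularity forces
the minimal polynomial to have degree `n`. -/
theorem jacobi_pow_apply_zero [NeZero n] (k : ℕ) :
    (∀ a : Fin n, k < a → (jacobi n ^ k) a 0 = 0) ∧
      ∀ a : Fin n, (a : ℕ) = k → (jacobi n ^ k) a 0 ≠ 0 := by
  induction k with
  | zero =>
    refine ⟨fun a ha => ?_, fun a ha => ?_⟩
    · rw [pow_zero, one_apply_ne]
      rintro rfl
      simp at ha
    · have : a = 0 := Fin.ext (by simpa using ha)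
      simp [this]
  | succ k ih =>
    refine ⟨fun a ha => ?_, fun a ha => ?_⟩
    · rw [pow_succ', mul_apply]
      refine Finset.sum_eq_zero fun c _ => ?_
      by_cases hc : k < c
      · rw [ih.1 c hc, mul_zero]
      · simp only [jacobi, of_apply]
        rw [if_neg (by omega), if_neg (by omega), zero_mul]
    · rw [pow_succ', mul_apply, Finset.sum_eq_single (⟨k, by omega⟩ : Fin n)]
      · refine mul_ne_zero ?_ (ih.2 _ rfl)
        simp only [jacobi, of_apply]
        rw [if_neg (by omega), if_pos ha]
        exact neg_ne_zero.2 Complex.I_ne_zero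
      · intro c _ hck
        have hck' : (c : ℕ) ≠ k := fun h => hck (Fin.ext h)
        by_cases hc : k < c
        · rw [ih.1 c hc, mul_zero]
        · simp only [jacobi, of_apply]
          rw [if_neg (by omega), if_neg (by omega), zero_mul]
      · simp

theorem natDegree_minpoly_jacobi [NeZero n] : (minpoly ℂ (jacobi n)).natDegree = n := by
  by_contra hne
  have hlt := lt_of_le_of_ne (natDegree_minpoly_le (jacobi n)) hne
  have h := minpoly.aeval ℂ (jacobi n)
  rw [aeval_eq_sum_range, Finset.sum_range_succ, coeff_natDegree,
    (minpoly.monic (Algebra.IsIntegral.isIntegral (jacobi n))).leadingCoeff, one_smul] at h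
  have h1 := congrFun (congrFun h ⟨_, hlt⟩) 0
  rw [Matrix.add_apply, Matrix.sum_apply, Finset.sum_eq_zero, zero_add] at h1
  · exact (jacobi_pow_apply_zero (minpoly ℂ (jacobi n)).natDegree).2 _ rfl h1
  · intro k hk
    rw [Matrix.smul_apply, (jacobi_pow_apply_zero k).1 _ (Finset.mem_range.1 hk), smul_zero]

open scoped ComplexOrder in
theorem eq_zero_of_trace_mul_conjTranspose_self {A : Matrix (Fin n) (Fin n) ℂ}
    (h : (A * Aᴴ).trace = 0) : A = 0 :=
  trace_mul_conjTranspose_self_eq_zero_iff.1 h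

/-- For `b = [x, a]` one has `bᴴ = [aᴴ, x]`, and `tr (b * [aᴴ, x]) = 0` as soon as `b` commutes with
`x`. Thus `ad x` has no nilpotent part on its generalized kernel. -/
theorem commute_of_double_commutator_eq_zero {x a : Matrix (Fin n) (Fin n) ℂ} (hx : xᴴ = x)
    (h : x * (x * a - a * x) = (x * a - a * x) * x) : x * a = a * x := by
  rw [← sub_eq_zero]
  apply eq_zero_of_trace_mul_conjTranspose_self
  set b := x * a - a * x with hb
  have hbH : bᴴ = aᴴ * x - x * aᴴ := by
    rw [hb, conjTranspose_sub, conjTranspose_mul, conjTranspose_mul, hx]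
  rw [hbH, mul_sub, trace_sub, ← mul_assoc, trace_mul_comm, ← mul_assoc, h, ← mul_assoc, sub_self]

theorem engel_le_centralizer {s : Series} {x : g s n}
    (hx : (x : Matrix (Fin n) (Fin n) ℂ)ᴴ = x) :
    (LieSubalgebra.engel ℂ x).toSubmodule ≤ centralizer x := by
  intro a ha
  obtain ⟨k, hk⟩ := (LieSubalgebra.mem_engel_iff ℂ x a).1 ha
  have hstep : ∀ b : g s n, LieAlgebra.ad ℂ (g s n) x (LieAlgebra.ad ℂ (g s n) x b) = 0 →
      LieAlgebra.ad ℂ (g s n) x b = 0 := by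
    intro b hb
    have h1 : LieAlgebra.ad ℂ (g s n) x b ∈ centralizer x := LinearMap.mem_ker.2 hb
    rw [mem_centralizer, LieAlgebra.ad_apply, LieSubalgebra.coe_bracket,
      LieRing.of_associative_ring_bracket] at h1
    exact LinearMap.mem_ker.1
      (mem_centralizer.2 (commute_of_double_commutator_eq_zero hx h1) : b ∈ centralizer x)
  have hall : ∀ k, (LieAlgebra.ad ℂ (g s n) x ^ (k + 1)) a = 0 →
      LieAlgebra.ad ℂ (g s n) x a = 0 := by
    intro k
    induction k with
    | zero => intro h; simpa using h
    | succ k ih =>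
      intro h
      apply ih
      rw [pow_succ', Module.End.mul_apply]
      rw [pow_succ', pow_succ', Module.End.mul_apply, Module.End.mul_apply] at h
      exact hstep _ h
  refine LinearMap.mem_ker.2 (hall k ?_)
  rw [pow_succ', Module.End.mul_apply, hk, map_zero]

theorem centralizer_le_engel {s : Series} (x : g s n) :
    centralizer x ≤ (LieSubalgebra.engel ℂ x).toSubmodule := fun a ha =>
  (LieSubalgebra.mem_engel_iff ℂ x a).2 ⟨1, by rw [pow_one]; exact LinearMap.mem_ker.1 ha⟩

/-- The rank is the least dimension of an Engel subalgebra. Each of these contains a centralizer, of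
dimension at least the number of invariants; for the Jacobi matrix the two coincide and the bound is
attained. -/
theorem rank_g (s : Series) (hn : 0 < n) : LieAlgebra.rank ℂ (g s n) = numInvariants s n := by
  have : NeZero n := ⟨hn.ne'⟩
  apply le_antisymm
  · let x : g s n := ⟨jacobi n, jacobi_mem s n⟩
    have h1 := LieAlgebra.rank_le_finrank_engel ℂ x
    have h2 := Submodule.finrank_mono (engel_le_centralizer (x := x) (conjTranspose_jacobi n))
    have h3 : finrank ℂ (centralizer x) = numInvariants s n := by
      rw [finrank_centralizer]
      cases s with
      | gl => exact finrank_commutant_gl_eq_iff.2 natDegree_minpoly_jacobi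
      | so =>
        exact (finrank_commutant_so_eq_iff (transpose_jacobi n)).2 (Or.inl natDegree_minpoly_jacobi)
    exact (h1.trans h2).trans h3.le
  · obtain ⟨x, hx⟩ := LieAlgebra.exists_isRegular ℂ (g s n)
    rw [← (LieAlgebra.isRegular_iff_finrank_engel_eq_rank ℂ x).1 hx]
    exact (numInvariants_le_finrank_centralizer x).trans
      (Submodule.finrank_mono (centralizer_le_engel x))

theorem isRegular_iff {s : Series} (hn : 0 < n) (X : g s n) :
    IsRegular X ↔
      finrank ℂ (commutant s (X : Matrix (Fin n) (Fin n) ℂ)) = numInvariants s n := by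
  rw [IsRegular, rank_g s hn, finrank_centralizer]

end Rank

end GelfandZeitlin

namespace GelfandZeitlin

open Matrix Module

/-! ### Differentials as gradient matrices. -/

section Differential

variable {n : ℕ}

/-- As `X` and `Z` need not commute, only the traces of the derivative against powers of `X` are
recorded; cyclicity of the trace collapses them, and the free exponent `m` carries the induction. -/
theorem exists_hasDerivAt_pow (X Z : Matrix (Fin n) (Fin n) ℂ) (j : ℕ) :
    ∃ D : Matrix (Fin n) (Fin n) ℂ,
      (∀ a b, HasDerivAt (fun t : ℂ => ((X + t • Z) ^ j) a b) (D a b) 0) ∧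
      ∀ m, (D * X ^ m).trace = j * (X ^ (j + m - 1) * Z).trace := by
  induction j with
  | zero => exact ⟨0, fun a b => by simpa using hasDerivAt_const _ _, fun m => by simp⟩
  | succ j ih =>
    obtain ⟨D, hD, htr⟩ := ih
    refine ⟨D * X + X ^ j * Z, fun a b => ?_, fun m => ?_⟩
    · have hZ : ∀ c, HasDerivAt (fun t : ℂ => (X + t • Z) c b) (Z c b) 0 := fun c => by
        simpa using ((hasDerivAt_id (0 : ℂ)).mul_const (Z c b)).const_add (X c b)
      have h := HasDerivAt.fun_sum (u := Finset.univ) fun c _ => (hD a c).fun_mul (hZ c)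
      simp_rw [pow_succ, mul_apply]
      refine h.congr_deriv ?_
      simp [mul_apply, Finset.sum_add_distrib]
    · rw [add_mul, trace_add, mul_assoc, ← pow_succ', htr, mul_assoc, trace_mul_comm (X ^ j),
        mul_assoc, trace_mul_comm Z, ← pow_add]
      rw [show j + (m + 1) - 1 = j + m by omega, show j + 1 + m - 1 = j + m by omega,
        add_comm m j]
      push_cast
      ring

theorem hasDerivAt_trace_pow (X Z : Matrix (Fin n) (Fin n) ℂ) (j : ℕ) :
    HasDerivAt (fun t : ℂ => ((X + t • Z) ^ j).trace) ((j : ℂ) • X ^ (j - 1) * Z).trace 0 := by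
  obtain ⟨D, hD, htr⟩ := exists_hasDerivAt_pow X Z j
  have h := HasDerivAt.fun_sum (u := Finset.univ) fun a _ => hD a a
  refine h.congr_deriv ?_
  have := htr 0
  rw [pow_zero, mul_one, add_zero] at this
  rw [smul_mul_assoc, trace_smul, smul_eq_mul, ← this]
  rfl

theorem hasDerivAt_invariant {s : Series} {j : ℕ} {X : ℂ → g s n} {X₀ Z : g s n}
    (hX : ∀ t, (X t : Matrix (Fin n) (Fin n) ℂ) = X₀ + t • (Z : Matrix (Fin n) (Fin n) ℂ)) :
    HasDerivAt (fun t => invariant s n j (X t))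
      (invariantGrad s (X₀ : Matrix (Fin n) (Fin n) ℂ) j * Z).trace 0 := by
  cases s with
  | gl =>
    simp only [invariant, invariantGrad, hX]
    exact hasDerivAt_trace_pow _ _ _
  | so =>
    simp only [invariant, invariantGrad, hX]
    split_ifs with h
    · rw [trace_pfGrad_mul _ (mem_g_so.1 Z.2)]
      exact hasDerivAt_pfaffian _ _
    · exact hasDerivAt_trace_pow _ _ _

theorem sum_eq_sum_castLE {i : ℕ} (hi : i ≤ n) {F : Fin n → ℂ} (hF : ∀ c : Fin n, i ≤ c → F c = 0) :
    ∑ c, F c = ∑ c : Fin i, F (Fin.castLE hi c) := by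
  refine Eq.trans ?_ (Finset.sum_map Finset.univ (Fin.castLEEmb hi) F)
  refine (Finset.sum_subset (Finset.subset_univ _) fun c _ hc => hF c ?_).symm
  by_contra! h
  exact hc (Finset.mem_map.2 ⟨⟨c, h⟩, Finset.mem_univ _, rfl⟩)

theorem embed_apply {i : ℕ} (Y : Matrix (Fin i) (Fin i) ℂ) (a b : Fin n) :
    embed i n Y a b = if h : (a : ℕ) < i ∧ (b : ℕ) < i then Y ⟨a, h.1⟩ ⟨b, h.2⟩ else 0 := rfl

theorem embed_castLE {i : ℕ} (hi : i ≤ n) (Y : Matrix (Fin i) (Fin i) ℂ) (a b : Fin i) :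
    embed i n Y (Fin.castLE hi a) (Fin.castLE hi b) = Y a b := by
  rw [embed_apply, dif_pos ⟨a.2, b.2⟩]
  rfl

theorem embed_eq_zero {i : ℕ} (Y : Matrix (Fin i) (Fin i) ℂ) {a b : Fin n}
    (h : ¬((a : ℕ) < i ∧ (b : ℕ) < i)) : embed i n Y a b = 0 := by
  rw [embed_apply, dif_neg h]

theorem embed_injective {i : ℕ} (hi : i ≤ n) : Function.Injective (embed i n) := by
  intro Y Y' h
  ext a b
  rw [← embed_castLE hi Y, h, embed_castLE]

theorem transpose_embed {i : ℕ} (Y : Matrix (Fin i) (Fin i) ℂ) :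
    (embed i n Y)ᵀ = embed i n Yᵀ := by
  ext a b
  simp only [transpose_apply, embed_apply, and_comm]

theorem embed_mem {s : Series} {i : ℕ} {Y : Matrix (Fin i) (Fin i) ℂ} (hY : Y ∈ g s i) :
    embed i n Y ∈ g s n := by
  cases s with
  | gl => exact mem_g_gl _
  | so => rw [mem_g_so, transpose_embed, mem_g_so.1 hY, map_neg]

theorem coe_cutoff_apply {s : Series} (x : g s n) {i : ℕ} (hi : i ≤ n) (a b : Fin i) :
    (cutoff x i hi : Matrix (Fin i) (Fin i) ℂ) a b =
      (x : Matrix (Fin n) (Fin n) ℂ) (Fin.castLE hi a) (Fin.castLE hi b) := rfl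

theorem trace_embed_mul {s : Series} {i : ℕ} (hi : i ≤ n) (Y : Matrix (Fin i) (Fin i) ℂ)
    (z : g s n) :
    (embed i n Y * (z : Matrix (Fin n) (Fin n) ℂ)).trace =
      (Y * (cutoff z i hi : Matrix (Fin i) (Fin i) ℂ)).trace := by
  simp only [trace, diag_apply, mul_apply]
  rw [sum_eq_sum_castLE hi]
  · refine Finset.sum_congr rfl fun a _ => ?_
    rw [sum_eq_sum_castLE hi]
    · simp only [embed_castLE, coe_cutoff_apply]
    · intro c hc
      rw [embed_eq_zero _ (by omega), zero_mul]
  · intro c hc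
    refine Finset.sum_eq_zero fun b _ => ?_
    rw [embed_eq_zero _ (by omega), zero_mul]

/-- The gradient of `f i j` at `x`, as a matrix. -/
noncomputable def grad {s : Series} (x : g s n) (p : Index s n) : Matrix (Fin n) (Fin n) ℂ :=
  embed p.1.1 n
    (invariantGrad s (cutoff x p.1.1 p.2.1.2 : Matrix (Fin p.1.1) (Fin p.1.1) ℂ) p.1.2)

theorem differential_f {s : Series} (x : g s n) (p : Index s n) (z : g s n) :
    differential (f s n p) x z = (grad x p * (z : Matrix (Fin n) (Fin n) ℂ)).trace := by
  rw [grad, trace_embed_mul p.2.1.2]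
  refine HasDerivAt.deriv (hasDerivAt_invariant (X := fun t => cutoff (x + t • z) p.1.1 p.2.1.2)
    fun t => ?_)
  ext a b
  simp [coe_cutoff_apply]

theorem grad_mem {s : Series} (x : g s n) (p : Index s n) : grad x p ∈ g s n :=
  embed_mem (invariantGrad_mem_commutant (cutoff x p.1.1 p.2.1.2).2 p.2.2.1).1

theorem conjTranspose_mem {s : Series} {A : Matrix (Fin n) (Fin n) ℂ} (hA : A ∈ g s n) :
    Aᴴ ∈ g s n := by
  cases s with
  | gl => exact mem_g_gl _
  | so =>
    have h : (Aᴴ)ᵀ = (Aᵀ)ᴴ := rfl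
    rw [mem_g_so, h, mem_g_so.1 hA, conjTranspose_neg]

/-- The trace form as a map from `𝔤ₙ` to functions on `𝔤ₙ`. -/
noncomputable def traceForm (s : Series) (n : ℕ) : g s n →ₗ[ℂ] (g s n → ℂ) where
  toFun A z := ((A : Matrix (Fin n) (Fin n) ℂ) * (z : Matrix (Fin n) (Fin n) ℂ)).trace
  map_add' A B := by ext z; simp [add_mul]
  map_smul' c A := by ext z; simp

/-- Both series are stable under conjugate transposition, and `tr (A * Aᴴ)` vanishes only for `A =
0`. -/
theorem traceForm_injective (s : Series) (n : ℕ) : Function.Injective (traceForm s n) := by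
  rw [injective_iff_map_eq_zero]
  intro A hA
  have h := congrFun hA ⟨_, conjTranspose_mem A.2⟩
  exact Subtype.ext (eq_zero_of_trace_mul_conjTranspose_self h)

theorem isStronglyRegular_iff {s : Series} (x : g s n) :
    IsStronglyRegular x ↔ LinearIndependent ℂ (grad x) := by
  have h1 : (fun p : Index s n => differential (f s n p) x) =
      traceForm s n ∘ fun p => ⟨grad x p, grad_mem x p⟩ := by
    ext p z
    exact differential_f x p z
  rw [IsStronglyRegular, h1,
    (traceForm s n).linearIndependent_iff (LinearMap.ker_eq_bot.2 (traceForm_injective s n)),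
    ← (g s n).toSubmodule.subtype.linearIndependent_iff (Submodule.ker_subtype _)]
  rfl

end Differential

/-! ### Assembling the levels. -/

section Main

variable {n : ℕ} {s : Series}

theorem cutoffCentralizer_eq_map (x : g s n) {i : ℕ} (hi : i ≤ n) :
    cutoffCentralizer x i hi =
      (commutant s (cutoff x i hi : Matrix (Fin i) (Fin i) ℂ)).map (embed i n) := by
  rw [cutoffCentralizer, Submodule.map_comp, map_centralizer]

theorem finrank_cutoffCentralizer (x : g s n) {i : ℕ} (hi : i ≤ n) :
    finrank ℂ (cutoffCentralizer x i hi) =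
      finrank ℂ (commutant s (cutoff x i hi : Matrix (Fin i) (Fin i) ℂ)) := by
  rw [cutoffCentralizer_eq_map]
  exact (Submodule.equivMapOfInjective _ (embed_injective hi) _).finrank_eq.symm

/-- In terms of `n × n` entries, the commutation condition at level `i` is visibly implied by the
one at level `i + 1`, leaving only the support to check when descending. -/
theorem mem_cutoffCentralizer (x : g s n) {i : ℕ} (hi : i ≤ n) {A : Matrix (Fin n) (Fin n) ℂ} :
    A ∈ cutoffCentralizer x i hi ↔ A ∈ g s n ∧
      (∀ a b : Fin n, ¬((a : ℕ) < i ∧ (b : ℕ) < i) → A a b = 0) ∧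
      ∀ a b : Fin n, (a : ℕ) < i → (b : ℕ) < i →
        ((x : Matrix (Fin n) (Fin n) ℂ) * A) a b = (A * (x : Matrix (Fin n) (Fin n) ℂ)) a b := by
  have hmul : ∀ Y : Matrix (Fin i) (Fin i) ℂ, ∀ a b : Fin i,
      ((x : Matrix (Fin n) (Fin n) ℂ) * embed i n Y) (Fin.castLE hi a) (Fin.castLE hi b) =
        ((cutoff x i hi : Matrix (Fin i) (Fin i) ℂ) * Y) a b ∧
      (embed i n Y * (x : Matrix (Fin n) (Fin n) ℂ)) (Fin.castLE hi a) (Fin.castLE hi b) =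
        (Y * (cutoff x i hi : Matrix (Fin i) (Fin i) ℂ)) a b := by
    intro Y a b
    constructor <;> rw [mul_apply, mul_apply, sum_eq_sum_castLE hi]
    · simp only [embed_castLE, coe_cutoff_apply]
    · intro c hc
      rw [embed_eq_zero _ (by omega), mul_zero]
    · simp only [embed_castLE, coe_cutoff_apply]
    · intro c hc
      rw [embed_eq_zero _ (by omega), zero_mul]
  rw [cutoffCentralizer_eq_map]
  constructor
  · rintro ⟨Y, ⟨hY, hc⟩, rfl⟩
    refine ⟨embed_mem hY, fun a b h => embed_eq_zero Y h, fun a b ha hb => ?_⟩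
    have h := hmul Y ⟨a, ha⟩ ⟨b, hb⟩
    rw [hc] at h
    exact h.1.trans h.2.symm
  · rintro ⟨hA, h0, hc⟩
    have hAe : embed i n (cutoff (⟨A, hA⟩ : g s n) i hi : Matrix (Fin i) (Fin i) ℂ) = A := by
      ext a b
      rw [embed_apply]
      split_ifs with h
      · rfl
      · exact (h0 a b h).symm
    refine ⟨_, ⟨(cutoff (⟨A, hA⟩ : g s n) i hi).2, ?_⟩, hAe⟩
    ext a b
    have h := hmul (cutoff (⟨A, hA⟩ : g s n) i hi : Matrix (Fin i) (Fin i) ℂ) a b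
    rw [hAe] at h
    rw [← h.1, ← h.2]
    exact hc _ _ a.2 b.2

/-- The members of the index set at a given level. -/
def levelIndex {i : ℕ} (h1 : 1 ≤ i) (hi : i ≤ n) (j : Fin (numInvariants s i)) : Index s n :=
  ⟨(i, (j : ℕ) + 1), ⟨h1, hi⟩, ⟨by omega, by have := j.2; exact this⟩⟩

theorem levelIndex_injective {i : ℕ} (h1 : 1 ≤ i) (hi : i ≤ n) :
    Function.Injective (levelIndex (s := s) h1 hi) := by
  intro j k h
  have := congrArg (fun p : Index s n => p.1.2) h
  exact Fin.ext (Nat.succ_injective this)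

theorem range_levelIndex {i : ℕ} (h1 : 1 ≤ i) (hi : i ≤ n) :
    Set.range (levelIndex (s := s) h1 hi) = {p | p.1.1 = i} := by
  ext p
  constructor
  · rintro ⟨j, rfl⟩; rfl
  · rintro rfl
    refine ⟨⟨p.1.2 - 1, ?_⟩, ?_⟩
    · have := p.2.2; omega
    · apply Subtype.ext
      have := p.2.2.1
      exact Prod.ext rfl (Nat.sub_add_cancel this)

theorem linearIndependent_grad_levelIndex_iff (x : g s n) {i : ℕ} (h1 : 1 ≤ i) (hi : i ≤ n) :
    LinearIndependent ℂ (grad x ∘ levelIndex (s := s) h1 hi) ↔ IsRegular (cutoff x i hi) := by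
  rw [isRegular_iff (by omega), ← linearIndependent_invariantGrad_iff (by omega) (cutoff x i hi).2]
  exact (embed i n).linearIndependent_iff (LinearMap.ker_eq_bot.2 (embed_injective hi))

theorem grad_mem_cutoffCentralizer (x : g s n) (p : Index s n) :
    grad x p ∈ cutoffCentralizer x p.1.1 p.2.1.2 := by
  rw [cutoffCentralizer_eq_map]
  exact Submodule.mem_map_of_mem
    (invariantGrad_mem_commutant (cutoff x p.1.1 p.2.1.2).2 p.2.2.1)

/-- The gradients lie in the centralizer, and independence makes the cutoff regular, so the
dimensions agree. -/
theorem span_grad_levelIndex (x : g s n) {i : ℕ} (h1 : 1 ≤ i) (hi : i ≤ n)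
    (h : LinearIndependent ℂ (grad x ∘ levelIndex (s := s) h1 hi)) :
    Submodule.span ℂ (grad x '' {p | p.1.1 = i}) = cutoffCentralizer x i hi := by
  rw [← range_levelIndex h1 hi, ← Set.range_comp]
  refine Submodule.eq_of_le_of_finrank_eq ?_ ?_
  · rw [Submodule.span_le]
    rintro _ ⟨j, rfl⟩
    exact grad_mem_cutoffCentralizer x (levelIndex h1 hi j)
  · rw [finrank_span_eq_card h, Fintype.card_fin, finrank_cutoffCentralizer]
    exact ((isRegular_iff (by omega) _).1
      ((linearIndependent_grad_levelIndex_iff x h1 hi).1 h)).symm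

/-- If consecutive centralizers meet trivially, the sum of all the centralizers is direct. -/
theorem eq_zero_of_sum_eq_zero (x : g s n)
    (hb : ∀ (i : ℕ) (_ : 1 ≤ i) (hi : i + 1 ≤ n),
      cutoffCentralizer x i (Nat.le_of_succ_le hi) ⊓ cutoffCentralizer x (i + 1) hi = ⊥)
    {S : ℕ → Matrix (Fin n) (Fin n) ℂ} (hS : ∀ i (hi : i ≤ n), S i ∈ cutoffCentralizer x i hi)
    {m : ℕ} (hm : m ≤ n + 1) (hsum : ∑ i ∈ Finset.range m, S i = 0) : ∀ i < m, S i = 0 := by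
  induction m with
  | zero => intro i hi; omega
  | succ m ih =>
    have hmem := (mem_cutoffCentralizer x (by omega)).1 (hS m (by omega))
    have hm0 : S m = 0 := by
      rw [Finset.sum_range_succ] at hsum
      -- `S m` is minus the sum of the lower terms, all supported in the `(m-1)`-corner. For `m ≤ 1`
      -- that corner is empty, so (b) is needed only from `m = 2` on.
      have hsupp : ∀ a b : Fin n, ¬((a : ℕ) < m - 1 ∧ (b : ℕ) < m - 1) → S m a b = 0 := by
        intro a b hab
        rw [eq_neg_of_add_eq_zero_right hsum, Matrix.neg_apply, Matrix.sum_apply, neg_eq_zero]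
        refine Finset.sum_eq_zero fun i hi => ?_
        rw [Finset.mem_range] at hi
        exact ((mem_cutoffCentralizer x (by omega)).1 (hS i (by omega))).2.1 a b (by omega)
      rcases Nat.lt_or_ge m 2 with h2 | h2
      · ext a b
        exact hsupp a b (by omega)
      · obtain ⟨k, rfl⟩ : ∃ k, m = k + 1 := ⟨m - 1, by omega⟩
        have hk : S (k + 1) ∈ cutoffCentralizer x k (by omega) :=
          (mem_cutoffCentralizer x _).2 ⟨hmem.1, hsupp,
            fun a b ha hb => hmem.2.2 a b (by omega) (by omega)⟩
        have := (Submodule.mem_inf.2 ⟨hk, hS (k + 1) (by omega)⟩ : S (k + 1) ∈ _)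
        rw [hb k (by omega) (by omega)] at this
        exact (Submodule.mem_bot ℂ).1 this
    intro i hi
    rcases Nat.lt_succ_iff_lt_or_eq.1 hi with h | rfl
    · rw [Finset.sum_range_succ, hm0, add_zero] at hsum
      exact ih (by omega) hsum i h
    · exact hm0

theorem linearIndependent_grad (x : g s n)
    (ha : ∀ (i : ℕ) (_ : 1 ≤ i) (hi : i ≤ n), IsRegular (cutoff x i hi))
    (hb : ∀ (i : ℕ) (_ : 1 ≤ i) (hi : i + 1 ≤ n),
      cutoffCentralizer x i (Nat.le_of_succ_le hi) ⊓ cutoffCentralizer x (i + 1) hi = ⊥) :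
    LinearIndependent ℂ (grad x) := by
  classical
  rw [linearIndependent_iff']
  intro t c hc p hp
  let S : ℕ → Matrix (Fin n) (Fin n) ℂ := fun i => ∑ q ∈ t with q.1.1 = i, c q • grad x q
  have hsum : ∑ i ∈ Finset.range (n + 1), S i = 0 := by
    rw [← hc]
    refine Finset.sum_fiberwise_of_maps_to (fun q _ => ?_) _
    have := q.2.1.2
    exact Finset.mem_range.2 (by omega)
  have hS : ∀ i (hi : i ≤ n), S i ∈ cutoffCentralizer x i hi := by
    intro i hi
    refine Submodule.sum_mem _ fun q hq => Submodule.smul_mem _ _ ?_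
    obtain rfl := (Finset.mem_filter.1 hq).2
    exact grad_mem_cutoffCentralizer x q
  have h0 := eq_zero_of_sum_eq_zero x hb hS le_rfl hsum p.1.1 (by have := p.2.1.2; omega)
  have hli : LinearIndepOn ℂ (grad x) {q | q.1.1 = p.1.1} := by
    rw [← range_levelIndex p.2.1.1 p.2.1.2,
      linearIndepOn_range_iff (levelIndex_injective p.2.1.1 p.2.1.2)]
    exact (linearIndependent_grad_levelIndex_iff x p.2.1.1 p.2.1.2).2 (ha _ p.2.1.1 p.2.1.2)
  exact linearIndepOn_iff'.1 hli _ c (fun q hq => (Finset.mem_filter.1 hq).2) h0 p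
    (Finset.mem_filter.2 ⟨hp, rfl⟩)

end Main

end GelfandZeitlin

theorem proposition2p7 (s : GelfandZeitlin.Series) (n : ℕ) (x : GelfandZeitlin.g s n) :
    GelfandZeitlin.IsStronglyRegular x ↔
      (∀ (i : ℕ) (_ : 1 ≤ i) (hi : i ≤ n),
        GelfandZeitlin.IsRegular (GelfandZeitlin.cutoff x i hi)) ∧
      (∀ (i : ℕ) (_ : 1 ≤ i) (hi : i + 1 ≤ n),
        GelfandZeitlin.cutoffCentralizer x i (Nat.le_of_succ_le hi) ⊓
          GelfandZeitlin.cutoffCentralizer x (i + 1) hi = ⊥) := by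
  rw [GelfandZeitlin.isStronglyRegular_iff]
  refine ⟨fun h => ?_, fun h => GelfandZeitlin.linearIndependent_grad x h.1 h.2⟩
  have hlevel : ∀ (i : ℕ) (h1 : 1 ≤ i) (hi : i ≤ n),
      LinearIndependent ℂ (GelfandZeitlin.grad x ∘ GelfandZeitlin.levelIndex h1 hi) :=
    fun i h1 hi => h.comp _ (GelfandZeitlin.levelIndex_injective h1 hi)
  refine ⟨fun i h1 hi =>
    (GelfandZeitlin.linearIndependent_grad_levelIndex_iff x h1 hi).1 (hlevel i h1 hi),
    fun i h1 hi => ?_⟩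
  rw [← GelfandZeitlin.span_grad_levelIndex x h1 _ (hlevel i h1 _),
    ← GelfandZeitlin.span_grad_levelIndex x (Nat.le_succ_of_le h1) hi (hlevel _ _ hi)]
  -- The two centralizers are now spans of disjoint parts of one independent family.
  refine (h.disjoint_span_image ?_).eq_bot
  rw [Set.disjoint_left]
  intro p (hp : p.1.1 = i) (hp' : p.1.1 = i + 1)
  omega
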